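/- Let $N\ge 4$ be a real number, $\nu=\frac N2-1$ and $\triangle=z\frac{\partial^2}{\partial z^2}+\frac N2\frac{\partial}{\partial z}$. Let $\Phi_\nu(X)=\sum_{k\ge0}\frac{(-1)^k}{k!\,\Gamma(\nu+k+1)}X^k$ and $J_\nu(\zeta)=(\zeta/2)^\nu\Phi_\nu(\zeta^2/4)$. Let $\lambda=j^2/4$, where $j$ is any positive zero of the Bessel function $J_\nu$ (these $\lambda$ are the eigenvalues of $-\triangle$ on $(0,1)$ with the Dirichlet condition at $z=1$), let $\theta_0\in\mathbb R$, and put $\Theta=\sqrt{\lambda}\,t+\theta_0$. (a) Let $f$ be an entire function and let $M,L\ge 0$ be integers. Then each of the two equations $$\Big(\frac{\partial^2}{\partial t^2}-\triangle\Big)y=t^M\cos(L\Theta)\,f(z)\qquad\text{and}\qquad\Big(\frac{\partial^2}{\partial t^2}-\triangle\Big)y=t^M\sin(L\Theta)\,f(z)$$ has a solution, for all $t\in\mathbb R$ and $z\in\mathbb C$, of the form $$y(t,z)=\sum_{m=0}^{M+1}t^m\big(\cos(L\Theta)\,Y_m(z)+\sin(L\Theta)\,Z_m(z)\big),$$ where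 $Y_m,Z_m$ are entire functions with $Y_m(1)=Z_m(1)=0$; if $f$ is real on the real axis, then $Y_m,Z_m$ can be chosen real on the real axis. (b) Let $\gamma=1+\frac2{N-2}$, $G(v)=\frac1\gamma\big(1-(1+v)^{-\gamma}\big)$, $G_I(v)=G'(v)-1=\sum_{\ell\ge1}G_{I\ell}v^\ell$ and $G_{II}(v)=\frac N2\big(vG'(v)-G(v)\big)=\sum_{\ell\ge2}G_{II\ell}v^\ell$ (Taylor series at $v=0$). Put $\phi(z)=\Phi_\nu(\lambda z)\Big/\Big(\int_0^1|\Phi_\nu(\lambda s)|^2s^{\frac N2-1}ds\Big)^{1/2}$. Then there are functions $y_k(t,z)$, $k\ge1$, with $y_1=\sin(\Theta)\,\phi(z)$, such that, with $v_j=-\frac{\partial y_j}{\partial z}$, for every $k\ge1$ $$\Big(\frac{\partial^2}{\partial t^2}-\triangle\Big)y_k=\sum_{\substack{\ell\ge1\\ j_1+\cdots+j_\ell+j=k}}G_{I\ell}\,v_{j_1}\cdots v_{j_\ell}\,\triangle y_j+\sum_{\substack{\ell\ge2\\ j_1+\cdots+j_\ell=k}}G_{II\ell}\,v_{j_1}\cdots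 v_{j_\ell},\qquad y_k|_{z=1}=0$$ (all indices $j_i,j\ge1$), and $$y_k(t,z)=\sum_{M=0}^{k-1}\sum_{L=0}^{k}t^M\big(\cos(L\Theta)\,V_{k,L,M}(z)+\sin(L\Theta)\,W_{k,L,M}(z)\big)$$ with entire functions $V_{k,L,M},W_{k,L,M}$ that are real on the real axis. (That is, $\sum_k y_k\varepsilon^k$ is a formal solution of $y_{tt}-\triangle y=G_I(v)\triangle y+G_{II}(v)$, $v=-\partial y/\partial z$, $y|_{z=1}=0$.) -/

import Mathlib

noncomputable section

/-- `Φ_ν(X) = ∑ₖ (-1)ᵏ / (k! Γ(ν + k + 1)) Xᵏ`, an entire function of `X` (for `ν > -1`). -/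
def besselPhi (ν : ℝ) (X : ℂ) : ℂ :=
  ∑' k : ℕ, (((-1 : ℝ) ^ k / ((k.factorial : ℝ) * Real.Gamma (ν + k + 1)) : ℝ) : ℂ) * X ^ k

/-- The Bessel function `J_ν(ζ) = (ζ/2)^ν Φ_ν(ζ²/4)`, for `ζ > 0`. -/
def besselJ (ν : ℝ) (ζ : ℝ) : ℂ :=
  (((ζ / 2) ^ ν : ℝ) : ℂ) * besselPhi ν ((ζ ^ 2 / 4 : ℝ) : ℂ)

/-- `lam` is one of the numbers `λ_n = (j_{ν,n})² / 4`, `n = 1, 2, …`, where `ν = N/2 - 1` and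
`j_{ν,n}` is the `n`-th positive zero of `J_ν`; these are the eigenvalues of `-△` on `(0, 1)`
with the Dirichlet condition at `z = 1`. -/
def IsDirichletEigenvalue (N lam : ℝ) : Prop :=
  ∃ j : ℝ, 0 < j ∧ besselJ (N / 2 - 1) j = 0 ∧ lam = j ^ 2 / 4

/-- The norm of the Hilbert space of functions on `(0, 1)` with weight `z ^ (N/2 - 1)`. -/
def weightedNorm (N : ℝ) (g : ℂ → ℂ) : ℝ :=
  Real.sqrt (∫ z in (0 : ℝ)..1, ‖g (z : ℂ)‖ ^ 2 * z ^ (N / 2 - 1))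

/-- The normalized eigenfunction `Φ_{N/2-1}(lam z) / ‖Φ_{N/2-1}(lam ·)‖`. -/
def eigenfunction (N lam : ℝ) (z : ℂ) : ℂ :=
  besselPhi (N / 2 - 1) ((lam : ℂ) * z) /
    ((weightedNorm N (fun w => besselPhi (N / 2 - 1) ((lam : ℂ) * w)) : ℝ) : ℂ)

/-- The operator `△ = z d²/dz² + (N/2) d/dz`. -/
def radialLaplacian (N : ℝ) (g : ℂ → ℂ) (z : ℂ) : ℂ :=
  z * deriv (deriv g) z + ((N / 2 : ℝ) : ℂ) * deriv g z

/-- `∂²y/∂t² - △ y`. -/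
def waveOp (N : ℝ) (y : ℝ → ℂ → ℂ) (t : ℝ) (z : ℂ) : ℂ :=
  deriv (deriv (fun s : ℝ => y s z)) t - radialLaplacian N (y t) z

/-- The phase `Θ(t) = √lam t + θ₀`. -/
def phase (lam θ₀ t : ℝ) : ℝ := Real.sqrt lam * t + θ₀

/-- `cos (L Θ(t))`. -/
def cosL (lam θ₀ : ℝ) (L : ℕ) (t : ℝ) : ℂ := ((Real.cos (L * phase lam θ₀ t) : ℝ) : ℂ)

/-- `sin (L Θ(t))`. -/
def sinL (lam θ₀ : ℝ) (L : ℕ) (t : ℝ) : ℂ := ((Real.sin (L * phase lam θ₀ t) : ℝ) : ℂ)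

/-- `g` takes real values on the real axis. -/
def RealOnReal (g : ℂ → ℂ) : Prop := ∀ x : ℝ, (g (x : ℂ)).im = 0

/-- The adiabatic exponent `γ = 1 + 2 / (N - 2)`. -/
def adiabaticExp (N : ℝ) : ℝ := 1 + 2 / (N - 2)

/-- `G(v) = (1 - (1 + v)^(-γ)) / γ`. -/
def gasG (N v : ℝ) : ℝ := 1 / adiabaticExp N * (1 - (1 + v) ^ (-adiabaticExp N))

/-- `G_I(v) = DG(v) - 1`. -/
def gasGI (N v : ℝ) : ℝ := deriv (gasG N) v - 1

/-- `G_II(v) = (N/2) (v DG(v) - G(v))`. -/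
def gasGII (N v : ℝ) : ℝ := N / 2 * (v * deriv (gasG N) v - gasG N v)

/-- The `l`-th Taylor coefficient at `0`. -/
def taylorCoef (g : ℝ → ℝ) (l : ℕ) : ℝ := iteratedDeriv l g 0 / (l.factorial : ℝ)

/-- The tuples `(j₁, …, j_n)` of positive integers with `j₁ + … + j_n = k`. -/
def posTuples (n k : ℕ) : Finset (Fin n → ℕ) :=
  (Finset.Nat.antidiagonalTuple n k).filter (fun j => ∀ i, 1 ≤ j i)

/-- The coefficient of `ε ^ k` in `G_I(v) △y + G_II(v)`, where `y = ∑_{k ≥ 1} y_k ε ^ k` and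
`v = -∂y/∂z`. -/
def expansionRHS (N : ℝ) (y : ℕ → ℝ → ℂ → ℂ) (k : ℕ) (t : ℝ) (z : ℂ) : ℂ :=
  (∑ l ∈ Finset.Icc 1 k, ∑ j ∈ posTuples (l + 1) k,
      (taylorCoef (gasGI N) l : ℂ) * (∏ i : Fin l, -deriv (y (j i.castSucc) t) z) *
        radialLaplacian N (y (j (Fin.last l)) t) z) +
    ∑ l ∈ Finset.Icc 2 k, ∑ j ∈ posTuples l k,
      (taylorCoef (gasGII N) l : ℂ) * ∏ i : Fin l, -deriv (y (j i) t) z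

/-- The function `∑_{m=0}^{M+1} t^m (cos(LΘ) Y_m(z) + sin(LΘ) Z_m(z))`. -/
def trigPoly (lam θ₀ : ℝ) (M L : ℕ) (Y Z : ℕ → ℂ → ℂ) (t : ℝ) (z : ℂ) : ℂ :=
  ∑ m ∈ Finset.range (M + 2),
    (t : ℂ) ^ m * (cosL lam θ₀ L t * Y m z + sinL lam θ₀ L t * Z m z)

/-- For the source term `s(t, z)`, the equation `∂²y/∂t² - △ y = s` has a solution
`∑_{m=0}^{M+1} t^m (cos(LΘ) Y_m(z) + sin(LΘ) Z_m(z))` with entire `Y_m`, `Z_m` vanishing at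
`z = 1`, which moreover are real on the real axis whenever `isReal` holds. -/
def HasTrigPolySolution (N lam θ₀ : ℝ) (M L : ℕ) (isReal : Prop) (s : ℝ → ℂ → ℂ) : Prop :=
  ∃ Y Z : ℕ → ℂ → ℂ,
    (∀ m, Differentiable ℂ (Y m) ∧ Differentiable ℂ (Z m)) ∧
    (∀ m, Y m 1 = 0 ∧ Z m 1 = 0) ∧
    (isReal → ∀ m, RealOnReal (Y m) ∧ RealOnReal (Z m)) ∧
    ∀ (t : ℝ) (z : ℂ), waveOp N (trigPoly lam θ₀ M L Y Z) t z = s t z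

end

/-!
Write `△ = z ∂² + b ∂` with `b = N / 2`, and `Φ = Φ_{b-1}`.

The equation `(△ + μ) u = g` is solved for entire `g` by a power series, whose coefficients satisfy a
two-term recurrence with denominators `(k + 1)(k + b)`; hence `u` is entire
(`entireSeq_of_recurrence`), and real on the real axis if `g` is. The kernel of `△ + μ` contains
`Φ(μ z)`. If `Φ(μ) ≠ 0`, a multiple of it restores the condition `u(1) = 0`. If `Φ(μ) = 0`, the
solvability defect is one-dimensional and is removed by subtracting from `g` a multiple `ψ` of
`Φ(μ z)`: differentiating `(△ + μ) Φ(μ z) = 0` in `μ` gives `(△ + μ)(z Φ'(μ z)) = -Φ(μ z)`, and the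
boundary value `Φ'(μ)` of `z Φ'(μ z)` is not zero, because at a double zero the Bessel equation would
force `Φ` to vanish identically (`deriv_besselPhi_ne_zero`). This argument, in
`exists_dirichlet_solution`, replaces the orthogonality relations of Sturm–Liouville theory.

For `y = ∑ t^m (cos(LΘ) Y_m + sin(LΘ) Z_m)` and `ω = L √lam` the wave equation is a system
for the coefficients `Y_m`, `Z_m` which is triangular in `m`. It is solved from the top degree downwards
(`exists_secular_coefficients`); a resonant `ψ` in the source of `t^M` is produced by a term
`t^(M+1)` with coefficient `ψ / (2 (M + 1) ω)`. Resonance needs `ω ≠ 0`, since `Φ(0) ≠ 0`.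

For the formal expansion, the functions of degree at most `m` in `t` and frequency at most `n` with
entire real coefficients form a space `secularSpace` that is stable under `∂/∂z` and `△`, and
degrees and frequencies add under products. The source of order `k` consists of products of at least
two factors of total order `k`; if `y_j` has degree `j - 1` and frequency `j` for `j < k`, the
source has degree at most `k - 2` and frequency at most `k` (`expansionRHS_mem`). Solving the wave equation
costs one power of `t`, so the bounds propagate to `y_k` (`expansionTerm_spec`).
-/

noncomputable section

/-! ### Everywhere convergent power series -/

/-- The coefficient sequences of everywhere convergent power series, described by
Cauchy-type bounds: `‖a k‖ r ^ k` is bounded for every radius `r`. -/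
def EntireSeq (a : ℕ → ℂ) : Prop := ∀ r : ℝ, 0 ≤ r → ∃ C, ∀ k, ‖a k‖ * r ^ k ≤ C

/-- The sum of the power series with coefficients `a`. -/
def powSum (a : ℕ → ℂ) (z : ℂ) : ℂ := ∑' k, a k * z ^ k

/-- The coefficients of the derivative of a power series. -/
def derivSeq (a : ℕ → ℂ) (k : ℕ) : ℂ := (k + 1) * a (k + 1)

theorem EntireSeq.summable_norm {a : ℕ → ℂ} (ha : EntireSeq a) {r : ℝ} (hr : 0 ≤ r) :
    Summable fun k => ‖a k‖ * r ^ k := by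
  obtain ⟨C, hC⟩ := ha (r + 1) (by linarith)
  have hq : r / (r + 1) < 1 := by rw [div_lt_one (by linarith)]; linarith
  have hq0 : 0 ≤ r / (r + 1) := by positivity
  refine Summable.of_nonneg_of_le (fun k => by positivity) (fun k => ?_)
    ((summable_geometric_of_lt_one hq0 hq).mul_left C)
  have h1 : ‖a k‖ * r ^ k = (‖a k‖ * (r + 1) ^ k) * (r / (r + 1)) ^ k := by
    rw [div_pow]; field_simp
  rw [h1]
  exact mul_le_mul_of_nonneg_right (hC k) (by positivity)

theorem EntireSeq.summable {a : ℕ → ℂ} (ha : EntireSeq a) (z : ℂ) :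
    Summable fun k => a k * z ^ k :=
  Summable.of_norm (by simpa using ha.summable_norm (norm_nonneg z))

theorem norm_derivSeq (a : ℕ → ℂ) (k : ℕ) : ‖derivSeq a k‖ = (k + 1) * ‖a (k + 1)‖ := by
  rw [derivSeq, norm_mul]
  congr 1
  exact_mod_cast Complex.norm_natCast (k + 1)

theorem EntireSeq.derivSeq {a : ℕ → ℂ} (ha : EntireSeq a) : EntireSeq (derivSeq a) := by
  intro r hr
  obtain ⟨C, hC⟩ := ha (2 * r + 1) (by linarith)
  refine ⟨C, fun k => le_trans ?_ (hC (k + 1))⟩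
  have h1 : ((k : ℝ) + 1) ≤ 2 ^ k := by exact_mod_cast Nat.lt_two_pow_self
  have h3 : ((k : ℝ) + 1) * r ^ k ≤ (2 * r + 1) ^ (k + 1) :=
    calc ((k : ℝ) + 1) * r ^ k ≤ 2 ^ k * r ^ k := by gcongr
      _ = (2 * r) ^ k := (mul_pow _ _ _).symm
      _ ≤ (2 * r + 1) ^ k := by gcongr; linarith
      _ ≤ (2 * r + 1) ^ (k + 1) := pow_le_pow_right₀ (by linarith) (Nat.le_succ k)
  rw [norm_derivSeq]
  calc ((k : ℝ) + 1) * ‖a (k + 1)‖ * r ^ k = ‖a (k + 1)‖ * (((k : ℝ) + 1) * r ^ k) := by ring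
    _ ≤ _ := by gcongr

theorem hasDerivAt_powSum {a : ℕ → ℂ} (ha : EntireSeq a) (z : ℂ) :
    HasDerivAt (powSum a) (powSum (derivSeq a) z) z := by
  set R : ℝ := ‖z‖ + 1
  have hR : 0 ≤ R := by positivity
  have hu : Summable fun n : ℕ => ‖a n‖ * (n * R ^ (n - 1)) := by
    rw [← summable_nat_add_iff 1]
    refine (ha.derivSeq.summable_norm hR).congr fun k => ?_
    rw [norm_derivSeq]
    push_cast
    ring
  have key := hasDerivAt_tsum_of_isPreconnected (g := fun n y => a n * y ^ n)
    (g' := fun n y => a n * (n * y ^ (n - 1))) (t := Metric.ball (0 : ℂ) R) (y₀ := 0) (y := z)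
    hu Metric.isOpen_ball (convex_ball _ _).isPreconnected
    (fun n y _ => (hasDerivAt_pow n y).const_mul (a n))
    (fun n y hy => by
      rw [norm_mul, norm_mul, norm_pow, Complex.norm_natCast]
      have : ‖y‖ ≤ R := by simpa using (mem_ball_zero_iff.mp hy).le
      gcongr)
    (by simpa using by positivity) (ha.summable 0) (by simp [R])
  have hs : (∑' n : ℕ, a n * (n * z ^ (n - 1))) = powSum (derivSeq a) z := by
    have hsum : Summable fun n : ℕ => a n * (n * z ^ (n - 1)) := by
      rw [← summable_nat_add_iff 1]
      refine (ha.derivSeq.summable z).congr fun k => ?_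
      rw [derivSeq]
      push_cast
      ring
    rw [hsum.tsum_eq_zero_add, powSum]
    simp only [Nat.cast_zero, zero_mul, mul_zero, zero_add]
    refine tsum_congr fun k => ?_
    rw [derivSeq]
    push_cast
    ring
  rw [hs] at key
  exact key

theorem deriv_powSum {a : ℕ → ℂ} (ha : EntireSeq a) : deriv (powSum a) = powSum (derivSeq a) :=
  funext fun z => (hasDerivAt_powSum ha z).deriv

theorem differentiable_powSum {a : ℕ → ℂ} (ha : EntireSeq a) : Differentiable ℂ (powSum a) :=
  fun z => (hasDerivAt_powSum ha z).differentiableAt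

theorem powSum_zero (a : ℕ → ℂ) : powSum a 0 = a 0 := by
  rw [powSum, tsum_eq_single 0 (fun k hk => by simp [hk])]
  simp

theorem realOnReal_powSum {a : ℕ → ℂ} (ha : EntireSeq a) (hre : ∀ k, (a k).im = 0) :
    RealOnReal (powSum a) := by
  intro x
  rw [powSum, Complex.im_tsum (ha.summable _)]
  have : ∀ k, (a k * (x : ℂ) ^ k).im = 0 := fun k => by
    rw [← Complex.ofReal_pow, Complex.im_mul_ofReal, hre, zero_mul]
  simp [this]

theorem realOnReal_deriv {g : ℂ → ℂ} (hg : Differentiable ℂ g) (hre : RealOnReal g) :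
    RealOnReal (deriv g) := by
  intro x
  have h1 := ((hg x).hasDerivAt).comp_ofReal
  have h2 := Complex.imCLM.hasFDerivAt.comp_hasDerivAt x h1
  have h3 : (Complex.imCLM ∘ fun y : ℝ => g y) = fun _ => (0 : ℝ) := funext fun y => hre y
  rw [h3] at h2
  exact h2.unique (hasDerivAt_const x (0 : ℝ))

/-- An entire function is the sum of its Taylor series at `0`, whose coefficients are real if the
function is real on the real axis. -/
theorem exists_entireSeq {g : ℂ → ℂ} (hg : Differentiable ℂ g) :
    ∃ a, EntireSeq a ∧ powSum a = g ∧ (RealOnReal g → ∀ k, (a k).im = 0) := by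
  have hsum : ∀ z, HasSum (fun k : ℕ => ((k.factorial : ℂ)⁻¹ * iteratedDeriv k g 0) * z ^ k) (g z) := by
    intro z
    refine (Complex.hasSum_taylorSeries_of_entire hg 0 z).congr_fun ?_
    intro k
    simp only [sub_zero, smul_eq_mul]
    ring
  refine ⟨fun k => (k.factorial : ℂ)⁻¹ * iteratedDeriv k g 0, ?_, ?_, ?_⟩
  · intro r hr
    have h := (hsum r).summable.tendsto_atTop_zero.norm.bddAbove_range
    obtain ⟨C, hC⟩ := h
    refine ⟨C, fun k => ?_⟩
    have := hC ⟨k, rfl⟩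
    simpa [abs_of_nonneg hr] using this
  · exact funext fun z => (hsum z).tsum_eq
  · intro hre k
    have h : ∀ k, Differentiable ℂ (iteratedDeriv k g) ∧ RealOnReal (iteratedDeriv k g) := by
      intro k
      induction k with
      | zero => simpa using ⟨hg, hre⟩
      | succ k ih =>
        rw [iteratedDeriv_succ]
        exact ⟨ih.1.deriv, realOnReal_deriv ih.1 ih.2⟩
    have h0 := (h k).2 0
    rw [Complex.ofReal_zero] at h0
    have : ((k.factorial : ℂ)⁻¹) = (((k.factorial : ℝ)⁻¹ : ℝ) : ℂ) := by push_cast; rfl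
    simp only [this, Complex.im_ofReal_mul, h0, mul_zero]

/-! ### Power series solutions of `z u'' + b u' + μ u = g` -/

theorem entireSeq_of_recurrence {b : ℝ} (hb : 0 < b) {μ : ℂ} {a g : ℕ → ℂ} (hg : EntireSeq g)
    (h : ∀ k : ℕ, ((k : ℂ) + 1) * (k + b) * a (k + 1) + μ * a k = g k) : EntireSeq a := by
  intro r hr
  obtain ⟨C, hC⟩ := hg r hr
  have hC0 : 0 ≤ C := le_trans (by positivity) (hC 0)
  -- beyond `K` the homogeneous part of the recurrence at least halves `‖a k‖ r ^ k`
  obtain ⟨K, hK⟩ := exists_nat_gt (2 * ‖μ‖ * r / b)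
  rw [div_lt_iff₀ hb] at hK
  set B := ∑ i ∈ Finset.range (K + 1), ‖a i‖ * r ^ i with hB
  have hB0 : 0 ≤ B := Finset.sum_nonneg fun i _ => by positivity
  set D := B + 2 * (C * r) / b with hD
  have hD0 : 0 ≤ D := by positivity
  have hDb : 2 * (C * r) ≤ D * b := by
    rw [hD, add_mul, div_mul_cancel₀ _ hb.ne']
    nlinarith
  refine ⟨D, fun k => ?_⟩
  have hsmall : ∀ i, i ≤ K → ‖a i‖ * r ^ i ≤ D := fun i hi => by
    have : ‖a i‖ * r ^ i ≤ B :=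
      Finset.single_le_sum (f := fun i => ‖a i‖ * r ^ i) (fun i _ => by positivity)
        (Finset.mem_range.2 (by omega))
    have : 0 ≤ 2 * (C * r) / b := by positivity
    linarith
  induction k with
  | zero => exact hsmall 0 (Nat.zero_le _)
  | succ k ih =>
    rcases Nat.lt_or_ge k K with hk | hk
    · exact hsmall _ hk
    · have hn : ‖((k : ℂ) + 1) * (k + b)‖ = ((k : ℝ) + 1) * (k + b) := by
        have : ((k : ℂ) + 1) * (k + b) = ((((k : ℝ) + 1) * (k + b) : ℝ) : ℂ) := by push_cast; rfl
        rw [this, Complex.norm_real, Real.norm_of_nonneg (by positivity)]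
      have h1 : ((k : ℝ) + 1) * (k + b) * ‖a (k + 1)‖ ≤ ‖g k‖ + ‖μ‖ * ‖a k‖ := by
        rw [← hn, ← norm_mul, ← norm_mul, eq_sub_of_add_eq (h k)]
        exact norm_sub_le _ _
      have hkK : (K : ℝ) ≤ k := by exact_mod_cast hk
      have h2 : ((k : ℝ) + 1) * (k + b) * (‖a (k + 1)‖ * r ^ (k + 1)) ≤ C * r + ‖μ‖ * r * D := by
        calc ((k : ℝ) + 1) * (k + b) * (‖a (k + 1)‖ * r ^ (k + 1))
            = ((k : ℝ) + 1) * (k + b) * ‖a (k + 1)‖ * r ^ (k + 1) := by ring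
          _ ≤ (‖g k‖ + ‖μ‖ * ‖a k‖) * r ^ (k + 1) := by gcongr
          _ = (‖g k‖ * r ^ k) * r + ‖μ‖ * r * (‖a k‖ * r ^ k) := by ring
          _ ≤ _ := by gcongr; exact hC k
      have h3 : C * r + ‖μ‖ * r * D ≤ ((k : ℝ) + 1) * (k + b) * D := by
        have h4 : ‖μ‖ * r * D ≤ (k * b / 2) * D := by
          gcongr
          nlinarith
        have h5 : 0 ≤ (k : ℝ) * k * D + k * D + k * b * D := by positivity
        nlinarith
      exact le_of_mul_le_mul_left (h2.trans h3) (by positivity)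

theorem powSum_natCast_mul {a : ℕ → ℂ} (ha : EntireSeq a) (z : ℂ) :
    HasSum (fun k : ℕ => (k * a k) * z ^ k) (z * powSum (derivSeq a) z) := by
  rw [← hasSum_nat_add_iff' 1]
  have := (ha.derivSeq.summable z).hasSum.mul_left z
  simp only [Finset.range_one, Finset.sum_singleton, Nat.cast_zero, zero_mul, sub_zero]
  refine this.congr_fun fun k => ?_
  rw [derivSeq]
  push_cast
  ring

/-- The differential equation is the recurrence on the coefficients. -/
theorem powSum_ode {b : ℝ} (hb : 0 < b) {μ : ℂ} {a g : ℕ → ℂ} (hg : EntireSeq g)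
    (h : ∀ k : ℕ, ((k : ℂ) + 1) * (k + b) * a (k + 1) + μ * a k = g k) (z : ℂ) :
    z * deriv (deriv (powSum a)) z + b * deriv (powSum a) z + μ * powSum a z = powSum g z := by
  have ha := entireSeq_of_recurrence hb hg h
  rw [deriv_powSum ha, deriv_powSum ha.derivSeq]
  have h1 := ((powSum_natCast_mul ha.derivSeq z).add
    ((ha.derivSeq.summable z).hasSum.mul_left (b : ℂ))).add ((ha.summable z).hasSum.mul_left μ)
  refine h1.unique ((hg.summable z).hasSum.congr_fun fun k => ?_)
  rw [← h k, derivSeq]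
  ring

/-- The coefficients, in terms of those of `g`, of the solution that vanishes at `0`. -/
def solSeq (b : ℝ) (μ : ℂ) (g : ℕ → ℂ) : ℕ → ℂ
  | 0 => 0
  | k + 1 => (g k - μ * solSeq b μ g k) / (((k : ℂ) + 1) * (k + b))

/-- Existence of an entire particular solution, without boundary condition. -/
theorem exists_entire_solution {b : ℝ} (hb : 0 < b) (μ : ℝ) {g : ℂ → ℂ}
    (hg : Differentiable ℂ g) :
    ∃ u : ℂ → ℂ, Differentiable ℂ u ∧ (RealOnReal g → RealOnReal u) ∧
      ∀ z, z * deriv (deriv u) z + b * deriv u z + μ * u z = g z := by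
  obtain ⟨a, ha, rfl, hre⟩ := exists_entireSeq hg
  have hrec : ∀ k : ℕ, ((k : ℂ) + 1) * (k + b) * solSeq b μ a (k + 1) + μ * solSeq b μ a k
      = a k := by
    intro k
    have h1 : ((k : ℂ) + 1) * (k + b) ≠ 0 := by
      have : ((k : ℂ) + 1) * (k + b) = ((((k : ℝ) + 1) * (k + b) : ℝ) : ℂ) := by push_cast; rfl
      rw [this]
      exact Complex.ofReal_ne_zero.2 (by positivity)
    rw [solSeq, mul_div_cancel₀ _ h1]
    ring
  have hs := entireSeq_of_recurrence hb ha hrec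
  refine ⟨powSum (solSeq b μ a), differentiable_powSum hs, fun h => ?_,
    powSum_ode hb ha hrec⟩
  refine realOnReal_powSum hs fun k => ?_
  induction k with
  | zero => simp [solSeq]
  | succ k ih =>
    have : ((k : ℂ) + 1) * (k + b) = ((((k : ℝ) + 1) * (k + b) : ℝ) : ℂ) := by push_cast; rfl
    rw [solSeq, this, Complex.div_ofReal_im, Complex.sub_im, Complex.im_ofReal_mul, hre h, ih]
    simp

/-! ### The function `Φ_ν` and the Bessel equation -/

/-- The Taylor coefficients of `Φ_ν`. -/
def besselSeq (ν : ℝ) (k : ℕ) : ℂ :=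
  (((-1 : ℝ) ^ k / ((k.factorial : ℝ) * Real.Gamma (ν + k + 1)) : ℝ) : ℂ)

theorem besselPhi_eq_powSum (ν : ℝ) : besselPhi ν = powSum (besselSeq ν) := rfl

theorem besselSeq_recurrence {b : ℝ} (hb : 0 < b) (k : ℕ) :
    ((k : ℂ) + 1) * (k + b) * besselSeq (b - 1) (k + 1) + (1 : ℂ) * besselSeq (b - 1) k = 0 := by
  have hpos : (0 : ℝ) < b - 1 + k + 1 := by
    have : (0 : ℝ) ≤ k := k.cast_nonneg
    linarith
  have hG : Real.Gamma (b - 1 + k + 1) ≠ 0 := (Real.Gamma_pos_of_pos hpos).ne'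
  have hf : (k.factorial : ℝ) ≠ 0 := by positivity
  have hk : (k : ℝ) + 1 ≠ 0 := by positivity
  have h1 : ((k : ℝ) + 1) * (k + b) * ((-1 : ℝ) ^ (k + 1) / (((k + 1).factorial : ℝ) *
      Real.Gamma (b - 1 + (k + 1 : ℕ) + 1))) +
      1 * ((-1 : ℝ) ^ k / ((k.factorial : ℝ) * Real.Gamma (b - 1 + k + 1))) = 0 := by
    have h2 : b - 1 + ((k + 1 : ℕ) : ℝ) + 1 = (b - 1 + k + 1) + 1 := by push_cast; ring
    have h3 : (k : ℝ) + b = b - 1 + k + 1 := by ring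
    rw [h2, Real.Gamma_add_one hpos.ne', Nat.factorial_succ, h3]
    push_cast
    field_simp
    ring
  have h4 := congrArg (fun x : ℝ => (x : ℂ)) h1
  simp only [besselSeq]
  push_cast at h4 ⊢
  exact h4

theorem entireSeq_zero : EntireSeq fun _ => 0 := fun _ _ => ⟨0, fun _ => by simp⟩

theorem entireSeq_besselSeq {b : ℝ} (hb : 0 < b) : EntireSeq (besselSeq (b - 1)) :=
  entireSeq_of_recurrence hb entireSeq_zero (besselSeq_recurrence hb)

theorem differentiable_besselPhi {b : ℝ} (hb : 0 < b) : Differentiable ℂ (besselPhi (b - 1)) :=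
  differentiable_powSum (entireSeq_besselSeq hb)

theorem realOnReal_besselPhi {b : ℝ} (hb : 0 < b) : RealOnReal (besselPhi (b - 1)) :=
  realOnReal_powSum (entireSeq_besselSeq hb) fun _ => Complex.ofReal_im _

theorem besselPhi_zero_ne {b : ℝ} (hb : 0 < b) : besselPhi (b - 1) 0 ≠ 0 := by
  rw [besselPhi_eq_powSum, powSum_zero, besselSeq]
  have := (Real.Gamma_pos_of_pos hb).ne'
  simpa using this

theorem besselPhi_ode {b : ℝ} (hb : 0 < b) (z : ℂ) :
    z * deriv (deriv (besselPhi (b - 1))) z + b * deriv (besselPhi (b - 1)) z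
      + besselPhi (b - 1) z = 0 := by
  have h := powSum_ode hb entireSeq_zero (besselSeq_recurrence hb) z
  rw [one_mul] at h
  rw [besselPhi_eq_powSum, h]
  simp [powSum]

/-- The Bessel equation differentiated `n` times. -/
theorem iteratedDeriv_ode {b : ℂ} {Φ : ℂ → ℂ} (hd : Differentiable ℂ Φ)
    (h : ∀ z, z * deriv (deriv Φ) z + b * deriv Φ z + Φ z = 0) (n : ℕ) :
    ∀ z, z * iteratedDeriv (n + 2) Φ z + (n + b) * iteratedDeriv (n + 1) Φ z
      + iteratedDeriv n Φ z = 0 := by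
  have hdn : ∀ n, Differentiable ℂ (iteratedDeriv n Φ) := fun n => by
    induction n with
    | zero => simpa using hd
    | succ n ih => rw [iteratedDeriv_succ]; exact ih.deriv
  induction n with
  | zero => simpa [iteratedDeriv_succ] using h
  | succ n ih =>
    intro z
    have hD : ∀ n, HasDerivAt (iteratedDeriv n Φ) (iteratedDeriv (n + 1) Φ z) z := fun n => by
      rw [iteratedDeriv_succ]; exact (hdn n z).hasDerivAt
    have h1 := (((hasDerivAt_id z).mul (hD (n + 2))).add
      ((hD (n + 1)).const_mul ((n : ℂ) + b))).add (hD n)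
    have h2 := (hasDerivAt_const z (0 : ℂ)).congr_of_eventuallyEq
      (Filter.Eventually.of_forall ih)
    have h3 := h1.unique h2
    simp only [id] at h3
    push_cast
    linear_combination h3

/-- Zeros of `Φ_ν` away from `0` are simple: at a double zero the Bessel equation and its
derivatives would force the whole Taylor series to vanish. -/
theorem deriv_besselPhi_ne_zero {b : ℝ} (hb : 0 < b) {μ : ℂ} (hμ : μ ≠ 0)
    (h : besselPhi (b - 1) μ = 0) : deriv (besselPhi (b - 1)) μ ≠ 0 := by
  intro h'
  have hd := differentiable_besselPhi hb
  have hode := iteratedDeriv_ode hd (besselPhi_ode hb)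
  have hvan : ∀ n, iteratedDeriv n (besselPhi (b - 1)) μ = 0 ∧
      iteratedDeriv (n + 1) (besselPhi (b - 1)) μ = 0 := by
    intro n
    induction n with
    | zero => simpa [iteratedDeriv_succ] using ⟨h, h'⟩
    | succ n ih =>
      refine ⟨ih.2, ?_⟩
      have := hode n μ
      rw [ih.1, ih.2] at this
      simpa [hμ] using this
  have h0 := Complex.taylorSeries_eq_of_entire hd μ 0
  simp only [(hvan _).1, smul_zero, tsum_zero] at h0
  exact besselPhi_zero_ne hb h0.symm

/-! ### The Dirichlet problem at `z = 1` in the space of entire functions -/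

theorem hasDerivAt_scaled (μ : ℂ) {F : ℂ → ℂ} (hF : Differentiable ℂ F) (z : ℂ) :
    HasDerivAt (fun w => F (μ * w)) (μ * deriv F (μ * z)) z := by
  have := (hF (μ * z)).hasDerivAt.comp z ((hasDerivAt_id z).const_mul μ)
  simpa [mul_comm, Function.comp_def] using this

/-- If `Φ` solves the Bessel equation, then `z ↦ Φ (μ z)` is in the kernel of `△ + μ`. -/
theorem scaled_ode {b : ℂ} {Φ : ℂ → ℂ} (hd : Differentiable ℂ Φ)
    (h : ∀ z, z * deriv (deriv Φ) z + b * deriv Φ z + Φ z = 0) (μ z : ℂ) :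
    z * deriv (deriv fun w => Φ (μ * w)) z + b * deriv (fun w => Φ (μ * w)) z
      + μ * Φ (μ * z) = 0 := by
  have e1 : (deriv fun w => Φ (μ * w)) = fun w => μ * deriv Φ (μ * w) :=
    funext fun w => (hasDerivAt_scaled μ hd w).deriv
  rw [e1, ((hasDerivAt_scaled μ hd.deriv z).const_mul μ).deriv]
  linear_combination μ * h (μ * z)

/-- Differentiating `(△ + μ) Φ (μ z) = 0` in `μ` gives `(△ + μ) (z Φ' (μ z)) = - Φ (μ z)`. -/
theorem scaled_deriv_ode {b : ℂ} {Φ : ℂ → ℂ} (hd : Differentiable ℂ Φ)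
    (h : ∀ z, z * deriv (deriv Φ) z + b * deriv Φ z + Φ z = 0) (μ z : ℂ) :
    z * deriv (deriv fun w => w * deriv Φ (μ * w)) z + b * deriv (fun w => w * deriv Φ (μ * w)) z
      + μ * (z * deriv Φ (μ * z)) = - Φ (μ * z) := by
  have e1 : (deriv fun w => w * deriv Φ (μ * w)) =
      fun w => 1 * deriv Φ (μ * w) + w * (μ * deriv (deriv Φ) (μ * w)) :=
    funext fun w => ((hasDerivAt_id w).mul (hasDerivAt_scaled μ hd.deriv w)).deriv
  have e2 := ((hasDerivAt_scaled μ hd.deriv z).const_mul 1).add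
    ((hasDerivAt_id z).mul ((hasDerivAt_scaled μ hd.deriv.deriv z).const_mul μ))
  have e3 : deriv (fun w => 1 * deriv Φ (μ * w) + w * (μ * deriv (deriv Φ) (μ * w))) z = _ :=
    e2.deriv
  rw [e1, e3]
  have h3 := iteratedDeriv_ode hd h 1 (μ * z)
  simp only [iteratedDeriv_succ, iteratedDeriv_zero] at h3
  simp only [id]
  push_cast at h3
  linear_combination h (μ * z) + (μ * z) * h3

/-- The operator `△ + μ`. -/
def shiftedLaplacian (N μ : ℝ) (g : ℂ → ℂ) (z : ℂ) : ℂ := radialLaplacian N g z + μ * g z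

theorem radialLaplacian_add (N : ℝ) {f g : ℂ → ℂ} (hf : Differentiable ℂ f)
    (hg : Differentiable ℂ g) (z : ℂ) : radialLaplacian N (fun w => f w + g w) z =
      radialLaplacian N f z + radialLaplacian N g z := by
  have h1 : (deriv fun w => f w + g w) = fun w => deriv f w + deriv g w :=
    funext fun w => deriv_fun_add (hf w) (hg w)
  rw [radialLaplacian, h1, deriv_fun_add (hf.deriv z) (hg.deriv z), radialLaplacian,
    radialLaplacian]
  ring

theorem radialLaplacian_const_mul (N : ℝ) {f : ℂ → ℂ} (hf : Differentiable ℂ f) (c : ℂ)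
    (z : ℂ) : radialLaplacian N (fun w => c * f w) z = c * radialLaplacian N f z := by
  have h1 : (deriv fun w => c * f w) = fun w => c * deriv f w :=
    funext fun w => deriv_const_mul c (hf w)
  rw [radialLaplacian, h1, deriv_const_mul c (hf.deriv z), radialLaplacian]
  ring

theorem shiftedLaplacian_add_const_mul (N μ : ℝ) {f g : ℂ → ℂ} (hf : Differentiable ℂ f)
    (hg : Differentiable ℂ g) (c : ℂ) (z : ℂ) : shiftedLaplacian N μ (fun w => f w + c * g w) z =
      shiftedLaplacian N μ f z + c * shiftedLaplacian N μ g z := by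
  rw [shiftedLaplacian, radialLaplacian_add N hf (hg.const_mul c),
    radialLaplacian_const_mul N hg, shiftedLaplacian, shiftedLaplacian]
  ring

theorem RealOnReal.add_ofReal_mul {f g : ℂ → ℂ} (hf : RealOnReal f) (hg : RealOnReal g) {c : ℂ}
    (hc : c.im = 0) : RealOnReal fun w => f w + c * g w := fun x => by
  simp [hf x, hg x, hc]

theorem RealOnReal.comp_ofReal_mul {f : ℂ → ℂ} (hf : RealOnReal f) (μ : ℝ) :
    RealOnReal fun w => f (μ * w) := fun x => by
  simpa using hf (μ * x)

/-- Fredholm alternative for `△ + μ` with the Dirichlet condition at `z = 1`: every entire `g` is in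
the range up to an element `ψ` of the kernel. Here `ψ = 0` unless `Φ_ν(μ) = 0`, and in
that case `ψ` is the multiple of `Φ_ν(μ z)` that corrects the boundary value of a particular
solution; the correction is possible because the zero `μ` of `Φ_ν` is simple. -/
theorem exists_dirichlet_solution {N : ℝ} (hN : 0 < N) (μ : ℝ) {g : ℂ → ℂ}
    (hg : Differentiable ℂ g) :
    ∃ ψ u : ℂ → ℂ, Differentiable ℂ ψ ∧ Differentiable ℂ u ∧
      (RealOnReal g → RealOnReal ψ ∧ RealOnReal u) ∧ ψ 1 = 0 ∧ u 1 = 0 ∧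
      (∀ z, shiftedLaplacian N μ ψ z = 0) ∧ (∀ z, shiftedLaplacian N μ u z = g z - ψ z) ∧
      (μ = 0 → ψ = 0) := by
  have hb : 0 < N / 2 := by positivity
  set Φ := besselPhi (N / 2 - 1) with hΦ
  have hd : Differentiable ℂ Φ := differentiable_besselPhi hb
  have hre : RealOnReal Φ := realOnReal_besselPhi hb
  have hode := besselPhi_ode hb
  rw [← hΦ] at hode
  obtain ⟨S, hS, hSre, hSeq⟩ := exists_entire_solution hb μ hg
  have hSeq' : ∀ z, shiftedLaplacian N μ S z = g z := hSeq
  set φ : ℂ → ℂ := fun w => Φ (μ * w) with hφ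
  have hμd : Differentiable ℂ fun w : ℂ => (μ : ℂ) * w := differentiable_id.const_mul _
  have hφd : Differentiable ℂ φ := hd.comp hμd
  have hφre : RealOnReal φ := hre.comp_ofReal_mul μ
  have hφeq : ∀ z, shiftedLaplacian N μ φ z = 0 := scaled_ode hd hode μ
  have hreal1 : ∀ {F : ℂ → ℂ}, RealOnReal F → (F 1).im = 0 := fun {F} hF => by
    simpa using hF 1
  have him : ∀ {p q : ℂ}, p.im = 0 → q.im = 0 → (p / q).im = 0 := fun {p q} hp hq => by
    simp [Complex.div_im, hp, hq]
  by_cases hres : φ 1 = 0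
  · -- at resonance `φ 1 = 0`, and the boundary value is corrected by `u₁`, `(△ + μ) u₁ = -φ`
    set u₁ : ℂ → ℂ := fun w => w * deriv Φ (μ * w) with hu₁
    have hu₁d : Differentiable ℂ u₁ := differentiable_id.mul (hd.deriv.comp hμd)
    have hu₁re : RealOnReal u₁ := fun x => by
      have := (realOnReal_deriv hd hre).comp_ofReal_mul μ x
      simp only [hu₁, Complex.im_ofReal_mul]
      rw [this, mul_zero]
    have hu₁eq : ∀ z, shiftedLaplacian N μ u₁ z = - φ z := scaled_deriv_ode hd hode μ
    have hφ1 : φ 1 = Φ μ := by simp [hφ]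
    have hμ : (μ : ℂ) ≠ 0 := fun h => by
      rw [hφ1, h] at hres
      exact besselPhi_zero_ne hb hres
    have hu₁1 : u₁ 1 ≠ 0 := by
      simpa [hu₁] using deriv_besselPhi_ne_zero hb hμ (hφ1.symm.trans hres)
    set a : ℂ := - (S 1 / u₁ 1) with ha
    have hare : RealOnReal g → a.im = 0 := fun h => by
      rw [ha, Complex.neg_im, him (hreal1 (hSre h)) (hreal1 hu₁re), neg_zero]
    refine ⟨fun w => 0 + a * φ w, fun w => S w + a * u₁ w, (hφd.const_mul a).const_add _,
      hS.add (hu₁d.const_mul a), fun h => ⟨?_, (hSre h).add_ofReal_mul hu₁re (hare h)⟩, ?_, ?_,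
      fun z => ?_, fun z => ?_, fun h => absurd h (by exact_mod_cast hμ)⟩
    · exact RealOnReal.add_ofReal_mul (fun x => by simp) hφre (hare h)
    · simp [hres]
    · simp only [ha]
      field_simp
      ring
    · rw [shiftedLaplacian_add_const_mul N μ (differentiable_const 0) hφd, hφeq]
      simp [shiftedLaplacian, radialLaplacian]
    · rw [shiftedLaplacian_add_const_mul N μ hS hu₁d, hSeq', hu₁eq]
      ring
  · -- without resonance the kernel element `φ` corrects the boundary value of `S`
    set a : ℂ := - (S 1 / φ 1) with ha
    refine ⟨0, fun w => S w + a * φ w, differentiable_const 0, hS.add (hφd.const_mul a),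
      fun h => ⟨fun x => by simp, (hSre h).add_ofReal_mul hφre ?_⟩, rfl, ?_, fun z => ?_,
      fun z => ?_, fun _ => rfl⟩
    · rw [ha, Complex.neg_im, him (hreal1 (hSre h)) (hreal1 hφre), neg_zero]
    · simp only [ha]
      field_simp
      ring
    · have h0 : deriv (0 : ℂ → ℂ) = 0 := funext fun w => by simp
      simp [shiftedLaplacian, radialLaplacian, h0]
    · rw [shiftedLaplacian_add_const_mul N μ hS hφd, hSeq', hφeq]
      simp

/-! ### Secular solutions -/

/-- The coefficient form of `∂²y/∂t² - △ y = s` for `y = ∑ t^m (cos ωt Y_m + sin ωt Z_m)`, where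
`K` stands for `△ + ω²` and `B` for the boundary condition: the system can be solved
from the highest power of `t` downwards. A source of degree `M - 1` in `t` is met at its top degree by
`K u = f - ψ`, and the resonant part `ψ` is produced by a term of degree `M`, which is where the
additional power of `t` comes from. -/
theorem exists_secular_coefficients {E : Type*} [AddCommGroup E] [Module ℝ E] (K : E →ₗ[ℝ] E)
    (B : Submodule ℝ E) (ω : ℝ)
    (H : ∀ g : E, ∃ ψ ∈ B, ∃ u ∈ B, K ψ = 0 ∧ K u = g - ψ ∧ (ω = 0 → ψ = 0)) (M : ℕ) :
    ∀ f g : ℕ → E, ∃ Y Z : ℕ → E, (∀ m, Y m ∈ B ∧ Z m ∈ B) ∧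
      (∀ m, M < m → Y m = 0 ∧ Z m = 0) ∧
      ∀ m : ℕ,
        (((m : ℝ) + 1) * (m + 2)) • Y (m + 2) + (2 * ((m : ℝ) + 1) * ω) • Z (m + 1) - K (Y m) =
          (if m < M then f m else 0) ∧
        (((m : ℝ) + 1) * (m + 2)) • Z (m + 2) - (2 * ((m : ℝ) + 1) * ω) • Y (m + 1) - K (Z m) =
          (if m < M then g m else 0) := by
  induction M with
  | zero => exact fun f g => ⟨0, 0, by simp [B.zero_mem], by simp, by simp⟩
  | succ M ih =>
    intro f g
    obtain ⟨ψ, hψ, u, hu, hKψ, hKu, hψ0⟩ := H (f M)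
    obtain ⟨χ, hχ, v, hv, hKχ, hKv, hχ0⟩ := H (g M)
    set c : ℝ := 2 * ((M : ℝ) + 1) * ω with hc
    -- for `ω = 0` the junk value `c⁻¹ = 0` is harmless, since then there is no resonant part
    have hcψ : ∀ x : E, (ω = 0 → x = 0) → c • c⁻¹ • x = x := fun x hx => by
      rcases eq_or_ne ω 0 with h | h
      · simp [hx h]
      · have : c ≠ 0 := mul_ne_zero (by positivity) h
        rw [smul_inv_smul₀ this]
    -- the contribution of the two highest powers `t ^ M` and `t ^ (M + 1)`
    let Y₁ : ℕ → E := fun m => if m = M then -u else if m = M + 1 then -(c⁻¹ • χ) else 0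
    let Z₁ : ℕ → E := fun m => if m = M then -v else if m = M + 1 then c⁻¹ • ψ else 0
    obtain ⟨Y₂, Z₂, hB, hvan, heq⟩ := ih
      (fun m => f m - ((((m : ℝ) + 1) * (m + 2)) • Y₁ (m + 2)
        + (2 * ((m : ℝ) + 1) * ω) • Z₁ (m + 1) - K (Y₁ m)))
      (fun m => g m - ((((m : ℝ) + 1) * (m + 2)) • Z₁ (m + 2)
        - (2 * ((m : ℝ) + 1) * ω) • Y₁ (m + 1) - K (Z₁ m)))
    refine ⟨fun m => Y₁ m + Y₂ m, fun m => Z₁ m + Z₂ m, fun m => ⟨?_, ?_⟩, fun m hm => ?_,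
      fun m => ?_⟩
    · refine B.add_mem ?_ (hB m).1
      simp only [Y₁]
      split_ifs
      exacts [B.neg_mem hu, B.neg_mem (B.smul_mem _ hχ), B.zero_mem]
    · refine B.add_mem ?_ (hB m).2
      simp only [Z₁]
      split_ifs
      exacts [B.neg_mem hv, B.smul_mem _ hψ, B.zero_mem]
    · have h1 : m ≠ M := by omega
      have h2 : m ≠ M + 1 := by omega
      simp [Y₁, Z₁, h1, h2, hvan m (by omega)]
    · have hY : (((m : ℝ) + 1) * (m + 2)) • (Y₁ (m + 2) + Y₂ (m + 2))
          + (2 * ((m : ℝ) + 1) * ω) • (Z₁ (m + 1) + Z₂ (m + 1)) - K (Y₁ m + Y₂ m) =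
          ((((m : ℝ) + 1) * (m + 2)) • Y₁ (m + 2)
            + (2 * ((m : ℝ) + 1) * ω) • Z₁ (m + 1) - K (Y₁ m)) +
          ((((m : ℝ) + 1) * (m + 2)) • Y₂ (m + 2)
            + (2 * ((m : ℝ) + 1) * ω) • Z₂ (m + 1) - K (Y₂ m)) := by
        rw [map_add, smul_add, smul_add]; abel
      have hZ : (((m : ℝ) + 1) * (m + 2)) • (Z₁ (m + 2) + Z₂ (m + 2))
          - (2 * ((m : ℝ) + 1) * ω) • (Y₁ (m + 1) + Y₂ (m + 1)) - K (Z₁ m + Z₂ m) =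
          ((((m : ℝ) + 1) * (m + 2)) • Z₁ (m + 2)
            - (2 * ((m : ℝ) + 1) * ω) • Y₁ (m + 1) - K (Z₁ m)) +
          ((((m : ℝ) + 1) * (m + 2)) • Z₂ (m + 2)
            - (2 * ((m : ℝ) + 1) * ω) • Y₂ (m + 1) - K (Z₂ m)) := by
        rw [map_add, smul_add, smul_add]; abel
      rw [hY, hZ, (heq m).1, (heq m).2]
      rcases lt_trichotomy m M with h | rfl | h
      · simp [h, h.trans (Nat.lt_succ_self M)]
      · have e1 : Y₁ (m + 2) = 0 := by simp [Y₁]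
        have e2 : Z₁ (m + 2) = 0 := by simp [Z₁]
        have e3 : Y₁ (m + 1) = -(c⁻¹ • χ) := by simp [Y₁]
        have e4 : Z₁ (m + 1) = c⁻¹ • ψ := by simp [Z₁]
        have e5 : Y₁ m = -u := by simp [Y₁]
        have e6 : Z₁ m = -v := by simp [Z₁]
        rw [e1, e2, e3, e4, e5, e6, ← hc, smul_neg, hcψ ψ hψ0, hcψ χ hχ0, map_neg, map_neg,
          hKu, hKv]
        simp
      · have e1 : Y₁ (m + 2) = 0 := by
          simp [Y₁, show m + 2 ≠ M by omega, show m + 1 ≠ M by omega]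
        have e2 : Z₁ (m + 2) = 0 := by
          simp [Z₁, show m + 2 ≠ M by omega, show m + 1 ≠ M by omega]
        have e3 : Y₁ (m + 1) = 0 := by
          simp [Y₁, show m + 1 ≠ M by omega, show m ≠ M by omega]
        have e4 : Z₁ (m + 1) = 0 := by
          simp [Z₁, show m + 1 ≠ M by omega, show m ≠ M by omega]
        have e5 : K (Y₁ m) = 0 := by
          simp only [Y₁]
          split_ifs <;> first | omega | simp [hKχ]
        have e6 : K (Z₁ m) = 0 := by
          simp only [Z₁]
          split_ifs <;> first | omega | simp [hKψ]
        rw [e1, e2, e3, e4, e5, e6]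
        simp [show ¬ m < M by omega, show ¬ m < M + 1 by omega]

/-- The real vector space of entire functions which, if `p` holds, are real on the real axis. The
two cases of `p` treat complex and real sources simultaneously. -/
def entireFun (p : Prop) : Submodule ℝ (ℂ → ℂ) where
  carrier := {f | Differentiable ℂ f ∧ (p → RealOnReal f)}
  zero_mem' := ⟨differentiable_const 0, fun _ x => by simp⟩
  add_mem' := fun hf hg => ⟨hf.1.add hg.1, fun h x => by simp [hf.2 h x, hg.2 h x]⟩
  smul_mem' := fun c f hf => ⟨hf.1.const_smul c, fun h x => by simp [hf.2 h x]⟩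

theorem mul_mem_entireFun {p : Prop} {f g : ℂ → ℂ} (hf : f ∈ entireFun p)
    (hg : g ∈ entireFun p) : (fun z => f z * g z) ∈ entireFun p :=
  ⟨hf.1.mul hg.1, fun h x => by simp [Complex.mul_im, hf.2 h x, hg.2 h x]⟩

theorem deriv_mem_entireFun {p : Prop} {f : ℂ → ℂ} (hf : f ∈ entireFun p) :
    deriv f ∈ entireFun p :=
  ⟨hf.1.deriv, fun h => realOnReal_deriv hf.1 (hf.2 h)⟩

theorem radialLaplacian_mem_entireFun {p : Prop} (N : ℝ) {f : ℂ → ℂ} (hf : f ∈ entireFun p) :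
    radialLaplacian N f ∈ entireFun p := by
  have hid : (fun z : ℂ => z) ∈ entireFun p := ⟨differentiable_id, fun _ x => by simp⟩
  have h := (entireFun p).add_mem
    (mul_mem_entireFun hid (deriv_mem_entireFun (deriv_mem_entireFun hf)))
    ((entireFun p).smul_mem (N / 2) (deriv_mem_entireFun hf))
  convert h using 1
  funext z
  simp [radialLaplacian]

/-- The operator `△ + μ` on entire functions. -/
def shiftedLaplacianLin (N μ : ℝ) (p : Prop) : entireFun p →ₗ[ℝ] entireFun p where
  toFun f := ⟨shiftedLaplacian N μ f, (entireFun p).add_mem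
    (radialLaplacian_mem_entireFun N f.2) (by
      have := (entireFun p).smul_mem μ f.2
      convert this using 1
      funext z
      simp)⟩
  map_add' f g := by
    ext z
    have := shiftedLaplacian_add_const_mul N μ f.2.1 g.2.1 1 z
    simpa [Pi.add_def] using this
  map_smul' c f := by
    ext z
    have := radialLaplacian_const_mul N f.2.1 c z
    simp only [shiftedLaplacian, Submodule.coe_smul, RingHom.id_apply, Pi.smul_def,
      Complex.real_smul, this]
    ring

/-- The entire functions that vanish at `1`. -/
def dirichletSubmodule (p : Prop) : Submodule ℝ (entireFun p) where
  carrier := {f | (f : ℂ → ℂ) 1 = 0}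
  zero_mem' := rfl
  add_mem' := fun {f g} hf hg => by
    simp only [Set.mem_ofPred_eq] at hf hg ⊢
    simp [hf, hg]
  smul_mem' := fun c f hf => by
    simp only [Set.mem_ofPred_eq] at hf ⊢
    simp [hf]

/-- The sum `∑_{m < n} t^m (cos(LΘ) A_m + sin(LΘ) B_m)` with constant coefficients. -/
def trigSum (lam θ₀ : ℝ) (L n : ℕ) (A B : ℕ → ℂ) (t : ℝ) : ℂ :=
  ∑ m ∈ Finset.range n, (t : ℂ) ^ m * (cosL lam θ₀ L t * A m + sinL lam θ₀ L t * B m)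

theorem hasDerivAt_cosL (lam θ₀ : ℝ) (L : ℕ) (t : ℝ) :
    HasDerivAt (cosL lam θ₀ L) (-((L * Real.sqrt lam : ℝ) : ℂ) * sinL lam θ₀ L t) t := by
  have h1 : HasDerivAt (fun t => (L : ℝ) * phase lam θ₀ t) (L * Real.sqrt lam) t := by
    have := (((hasDerivAt_id t).const_mul (Real.sqrt lam)).add_const θ₀).const_mul (L : ℝ)
    simpa [phase] using this
  have h2 := h1.cos.ofReal_comp
  refine h2.congr_deriv ?_
  simp only [sinL]
  push_cast
  ring

theorem hasDerivAt_sinL (lam θ₀ : ℝ) (L : ℕ) (t : ℝ) :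
    HasDerivAt (sinL lam θ₀ L) (((L * Real.sqrt lam : ℝ) : ℂ) * cosL lam θ₀ L t) t := by
  have h1 : HasDerivAt (fun t => (L : ℝ) * phase lam θ₀ t) (L * Real.sqrt lam) t := by
    have := (((hasDerivAt_id t).const_mul (Real.sqrt lam)).add_const θ₀).const_mul (L : ℝ)
    simpa [phase] using this
  have h2 := h1.sin.ofReal_comp
  refine h2.congr_deriv ?_
  simp only [cosL]
  push_cast
  ring

theorem hasDerivAt_ofReal_pow (m : ℕ) (t : ℝ) :
    HasDerivAt (fun s : ℝ => (s : ℂ) ^ m) (m * (t : ℂ) ^ (m - 1)) t :=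
  (hasDerivAt_pow m (t : ℂ)).comp_ofReal

/-- Time differentiation acts on the coefficients of a trigonometric sum. -/
theorem hasDerivAt_trigSum (lam θ₀ : ℝ) (L n : ℕ) {A B : ℕ → ℂ} (hA : A n = 0) (hB : B n = 0)
    (t : ℝ) : HasDerivAt (trigSum lam θ₀ L n A B)
      (trigSum lam θ₀ L n
        (fun m => ((m : ℂ) + 1) * A (m + 1) + ((L * Real.sqrt lam : ℝ) : ℂ) * B m)
        (fun m => ((m : ℂ) + 1) * B (m + 1) - ((L * Real.sqrt lam : ℝ) : ℂ) * A m) t) t := by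
  set ω : ℂ := ((L * Real.sqrt lam : ℝ) : ℂ)
  set c := cosL lam θ₀ L
  set s := sinL lam θ₀ L
  have h1 : HasDerivAt (trigSum lam θ₀ L n A B) (∑ m ∈ Finset.range n,
      (((m : ℂ) * (t : ℂ) ^ (m - 1)) * (c t * A m + s t * B m) +
        (t : ℂ) ^ m * (-ω * s t * A m + ω * c t * B m))) t := by
    unfold trigSum
    exact HasDerivAt.fun_sum fun m _ => (hasDerivAt_ofReal_pow m t).mul
      (((hasDerivAt_cosL lam θ₀ L t).mul_const (A m)).add
        ((hasDerivAt_sinL lam θ₀ L t).mul_const (B m)))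
  convert h1 using 1
  have h2 : ∑ m ∈ Finset.range n, ((m : ℂ) * (t : ℂ) ^ (m - 1)) * (c t * A m + s t * B m) =
      ∑ m ∈ Finset.range n, ((m : ℂ) + 1) * (t : ℂ) ^ m * (c t * A (m + 1) + s t * B (m + 1)) := by
    have e1 := Finset.sum_range_succ
      (fun m : ℕ => ((m : ℂ) * (t : ℂ) ^ (m - 1)) * (c t * A m + s t * B m)) n
    have e2 := Finset.sum_range_succ'
      (fun m : ℕ => ((m : ℂ) * (t : ℂ) ^ (m - 1)) * (c t * A m + s t * B m)) n
    rw [e1] at e2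
    simpa [hA, hB] using e2
  rw [Finset.sum_add_distrib, h2, ← Finset.sum_add_distrib, trigSum]
  refine Finset.sum_congr rfl fun m _ => ?_
  ring

theorem radialLaplacian_sum {ι : Type*} (N : ℝ) (s : Finset ι) {F : ι → ℂ → ℂ}
    (hF : ∀ i, Differentiable ℂ (F i)) (z : ℂ) :
    radialLaplacian N (fun w => ∑ i ∈ s, F i w) z = ∑ i ∈ s, radialLaplacian N (F i) z := by
  classical
  induction s using Finset.induction_on with
  | empty => simp [radialLaplacian]
  | insert i s hi ih =>
    simp only [Finset.sum_insert hi]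
    rw [radialLaplacian_add N (hF i) (Differentiable.fun_sum fun i _ => hF i), ih]

/-- `∂²/∂t² - △` acts on the coefficients of `∑ t^m (cos(LΘ) Y_m + sin(LΘ) Z_m)`. -/
theorem waveOp_trigPoly (N lam θ₀ : ℝ) (M L : ℕ) {Y Z : ℕ → ℂ → ℂ}
    (hY : ∀ m, Differentiable ℂ (Y m)) (hZ : ∀ m, Differentiable ℂ (Z m))
    (hvan : ∀ m, M + 1 < m → Y m = 0 ∧ Z m = 0) (t : ℝ) (z : ℂ) :
    waveOp N (trigPoly lam θ₀ M L Y Z) t z = trigSum lam θ₀ L (M + 2)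
      (fun m => ((m : ℂ) + 1) * (m + 2) * Y (m + 2) z
        + 2 * ((m : ℂ) + 1) * ((L * Real.sqrt lam : ℝ) : ℂ) * Z (m + 1) z
        - shiftedLaplacian N ((L * Real.sqrt lam) ^ 2) (Y m) z)
      (fun m => ((m : ℂ) + 1) * (m + 2) * Z (m + 2) z
        - 2 * ((m : ℂ) + 1) * ((L * Real.sqrt lam : ℝ) : ℂ) * Y (m + 1) z
        - shiftedLaplacian N ((L * Real.sqrt lam) ^ 2) (Z m) z) t := by
  have hY0 : ∀ m, M + 1 < m → Y m z = 0 := fun m hm => by rw [(hvan m hm).1]; rfl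
  have hZ0 : ∀ m, M + 1 < m → Z m z = 0 := fun m hm => by rw [(hvan m hm).2]; rfl
  have e1 : (fun s : ℝ => trigPoly lam θ₀ M L Y Z s z) =
      trigSum lam θ₀ L (M + 2) (fun m => Y m z) (fun m => Z m z) := rfl
  have e2 : deriv (trigSum lam θ₀ L (M + 2) (fun m => Y m z) (fun m => Z m z)) = _ :=
    funext fun s => (hasDerivAt_trigSum lam θ₀ L (M + 2) (hY0 _ (by omega)) (hZ0 _ (by omega))
      s).deriv
  have e3 := (hasDerivAt_trigSum lam θ₀ L (M + 2)
    (A := fun m => ((m : ℂ) + 1) * Y (m + 1) z + ((L * Real.sqrt lam : ℝ) : ℂ) * Z m z)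
    (B := fun m => ((m : ℂ) + 1) * Z (m + 1) z - ((L * Real.sqrt lam : ℝ) : ℂ) * Y m z)
    (by simp [hY0, hZ0]) (by simp [hY0, hZ0]) t).deriv
  have e4 : radialLaplacian N (trigPoly lam θ₀ M L Y Z t) z = ∑ m ∈ Finset.range (M + 2),
      (t : ℂ) ^ m * (cosL lam θ₀ L t * radialLaplacian N (Y m) z
        + sinL lam θ₀ L t * radialLaplacian N (Z m) z) := by
    have : trigPoly lam θ₀ M L Y Z t = fun w => ∑ m ∈ Finset.range (M + 2),
      (t : ℂ) ^ m * (cosL lam θ₀ L t * Y m w + sinL lam θ₀ L t * Z m w) := rfl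
    have hd : ∀ m, Differentiable ℂ fun w =>
        cosL lam θ₀ L t * Y m w + sinL lam θ₀ L t * Z m w := fun m =>
      ((hY m).const_mul _).add ((hZ m).const_mul _)
    rw [this, radialLaplacian_sum N _ fun m => (hd m).const_mul _]
    refine Finset.sum_congr rfl fun m _ => ?_
    rw [radialLaplacian_const_mul N (hd m),
      radialLaplacian_add N ((hY m).const_mul _) ((hZ m).const_mul _),
      radialLaplacian_const_mul N (hY m), radialLaplacian_const_mul N (hZ m)]
  rw [waveOp, e1, e2, e3, e4, trigSum, trigSum, ← Finset.sum_sub_distrib]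
  refine Finset.sum_congr rfl fun m _ => ?_
  simp only [shiftedLaplacian]
  push_cast
  ring

/-- The wave equation with source `t^M (cos(LΘ) f + sin(LΘ) g)`. -/
theorem hasTrigPolySolution {N : ℝ} (hN : 0 < N) (lam θ₀ : ℝ) (M L : ℕ) (p : Prop)
    {f g : ℂ → ℂ} (hf : Differentiable ℂ f) (hg : Differentiable ℂ g)
    (hfp : p → RealOnReal f) (hgp : p → RealOnReal g) :
    HasTrigPolySolution N lam θ₀ M L p
      (fun t z => (t : ℂ) ^ M * (cosL lam θ₀ L t * f z + sinL lam θ₀ L t * g z)) := by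
  set ω : ℝ := L * Real.sqrt lam with hω
  obtain ⟨Y, Z, hB, hvan, heq⟩ := exists_secular_coefficients (shiftedLaplacianLin N (ω ^ 2) p)
    (dirichletSubmodule p) ω (fun g => by
      obtain ⟨ψ, u, hψ, hu, hre, hψ1, hu1, hKψ, hKu, h0⟩ :=
        exists_dirichlet_solution hN (ω ^ 2) g.2.1
      refine ⟨⟨ψ, hψ, fun h => (hre (g.2.2 h)).1⟩, hψ1, ⟨u, hu, fun h => (hre (g.2.2 h)).2⟩, hu1,
        Subtype.ext (funext hKψ), Subtype.ext (funext hKu), fun h => Subtype.ext ?_⟩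
      exact h0 (by rw [h]; ring))
    (M + 1) (fun m => if m = M then ⟨f, hf, hfp⟩ else 0)
    (fun m => if m = M then ⟨g, hg, hgp⟩ else 0)
  refine ⟨fun m => Y m, fun m => Z m, fun m => ⟨(Y m).2.1, (Z m).2.1⟩, fun m => hB m,
    fun h m => ⟨(Y m).2.2 h, (Z m).2.2 h⟩, fun t z => ?_⟩
  rw [waveOp_trigPoly N lam θ₀ M L (fun m => (Y m).2.1) (fun m => (Z m).2.1)
    (fun m hm => by simp [hvan m hm]), trigSum, Finset.sum_eq_single M]
  · congr 2
    · congr 1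
      have := congrFun (congrArg Subtype.val (heq M).1) z
      simpa [shiftedLaplacianLin, ← hω] using this
    · congr 1
      have := congrFun (congrArg Subtype.val (heq M).2) z
      simpa [shiftedLaplacianLin, ← hω] using this
  · intro m _ hm
    have h1 := congrFun (congrArg Subtype.val (heq m).1) z
    have h2 := congrFun (congrArg Subtype.val (heq m).2) z
    simp only [hm, if_false, ite_self] at h1 h2
    have h1' : ((m : ℂ) + 1) * (m + 2) * (Y (m + 2) : ℂ → ℂ) z
        + 2 * ((m : ℂ) + 1) * (ω : ℂ) * (Z (m + 1) : ℂ → ℂ) z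
        - shiftedLaplacian N (ω ^ 2) (Y m) z = 0 := by
      simpa [shiftedLaplacianLin] using h1
    have h2' : ((m : ℂ) + 1) * (m + 2) * (Z (m + 2) : ℂ → ℂ) z
        - 2 * ((m : ℂ) + 1) * (ω : ℂ) * (Y (m + 1) : ℂ → ℂ) z
        - shiftedLaplacian N (ω ^ 2) (Z m) z = 0 := by
      simpa [shiftedLaplacianLin] using h2
    rw [h1', h2']
    simp
  · intro h
    exact absurd (Finset.mem_range.2 (by omega)) h

/-! ### Trigonometric polynomials with secular terms -/

/-- The real span of the functions `t^M (cos(LΘ) f(z) + sin(LΘ) g(z))` with `M ≤ m`, `L ≤ n` and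
`f`, `g` entire and real on the real axis. -/
def secularSpace (lam θ₀ : ℝ) (m n : ℕ) : Submodule ℝ (ℝ → ℂ → ℂ) :=
  Submodule.span ℝ {y | ∃ M L : ℕ, ∃ f ∈ entireFun True, ∃ g ∈ entireFun True, M ≤ m ∧ L ≤ n ∧
    y = fun (t : ℝ) (z : ℂ) => (t : ℂ) ^ M * (cosL lam θ₀ L t * f z + sinL lam θ₀ L t * g z)}

section

variable {lam θ₀ : ℝ} {m n : ℕ}

theorem monomial_mem_secularSpace {M L : ℕ} {f g : ℂ → ℂ} (hM : M ≤ m) (hL : L ≤ n)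
    (hf : f ∈ entireFun True) (hg : g ∈ entireFun True) :
    (fun (t : ℝ) (z : ℂ) => (t : ℂ) ^ M * (cosL lam θ₀ L t * f z + sinL lam θ₀ L t * g z)) ∈
      secularSpace lam θ₀ m n :=
  Submodule.subset_span ⟨M, L, f, hf, g, hg, hM, hL, rfl⟩

theorem secularSpace_mono {m' n' : ℕ} (hm : m ≤ m') (hn : n ≤ n') :
    secularSpace lam θ₀ m n ≤ secularSpace lam θ₀ m' n' := by
  refine Submodule.span_mono ?_
  rintro y ⟨M, L, f, hf, g, hg, hM, hL, rfl⟩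
  exact ⟨M, L, f, hf, g, hg, hM.trans hm, hL.trans hn, rfl⟩

theorem one_mem_secularSpace : (1 : ℝ → ℂ → ℂ) ∈ secularSpace lam θ₀ m n := by
  have h1 : (fun _ : ℂ => (1 : ℂ)) ∈ entireFun True := ⟨differentiable_const 1, fun _ x => by simp⟩
  convert monomial_mem_secularSpace (lam := lam) (θ₀ := θ₀) (Nat.zero_le m) (Nat.zero_le n) h1
    (entireFun True).zero_mem using 1
  funext t z
  simp [cosL]

/-- The product-to-sum formulas. -/
theorem monomial_mul_monomial_mem {m n M L M' L' : ℕ} {f g f' g' : ℂ → ℂ} (hM : M + M' ≤ m)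
    (hL : L + L' ≤ n) (hLL' : L' ≤ L) (hf : f ∈ entireFun True) (hg : g ∈ entireFun True)
    (hf' : f' ∈ entireFun True) (hg' : g' ∈ entireFun True) :
    (fun (t : ℝ) (z : ℂ) => (t : ℂ) ^ M * (cosL lam θ₀ L t * f z + sinL lam θ₀ L t * g z)) *
      (fun (t : ℝ) (z : ℂ) => (t : ℂ) ^ M' * (cosL lam θ₀ L' t * f' z + sinL lam θ₀ L' t * g' z)) ∈
      secularSpace lam θ₀ m n := by
  have hff := mul_mem_entireFun hf hf'
  have hfg := mul_mem_entireFun hf hg'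
  have hgf := mul_mem_entireFun hg hf'
  have hgg := mul_mem_entireFun hg hg'
  have h := (secularSpace lam θ₀ m n).smul_mem (1 / 2) ((secularSpace lam θ₀ m n).add_mem
    (monomial_mem_secularSpace hM hL ((entireFun True).sub_mem hff hgg)
      ((entireFun True).add_mem hfg hgf))
    (monomial_mem_secularSpace hM (L := L - L') (by omega) ((entireFun True).add_mem hff hgg)
      ((entireFun True).sub_mem hgf hfg)))
  convert h using 1
  funext t z
  simp only [Pi.mul_apply, Pi.smul_apply, Pi.add_apply, Pi.sub_apply, cosL, sinL,
    Nat.cast_add, Nat.cast_sub hLL', add_mul, sub_mul, Real.cos_add, Real.sin_add, Real.cos_sub,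
    Real.sin_sub, Complex.real_smul]
  push_cast
  ring

theorem mul_mem_secularSpace {m' n' : ℕ} {y y' : ℝ → ℂ → ℂ} (hy : y ∈ secularSpace lam θ₀ m n)
    (hy' : y' ∈ secularSpace lam θ₀ m' n') : y * y' ∈ secularSpace lam θ₀ (m + m') (n + n') := by
  have h := Submodule.mul_mem_mul hy hy'
  rw [secularSpace, secularSpace, Submodule.span_mul_span] at h
  refine Submodule.span_le.2 ?_ h
  rintro _ ⟨_, ⟨M, L, f, hf, g, hg, hM, hL, rfl⟩, _, ⟨M', L', f', hf', g', hg', hM', hL', rfl⟩, rfl⟩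
  rcases le_total L' L with hLL | hLL
  · exact monomial_mul_monomial_mem (by omega) (by omega) hLL hf hg hf' hg'
  · have := monomial_mul_monomial_mem (lam := lam) (θ₀ := θ₀) (m := m + m') (n := n + n')
      (M := M') (M' := M) (by omega) (by omega) hLL hf' hg' hf hg
    rw [mul_comm] at this
    exact this

theorem prod_mem_secularSpace {ι : Type*} (s : Finset ι) {F : ι → ℝ → ℂ → ℂ} {a b : ι → ℕ}
    (h : ∀ i ∈ s, F i ∈ secularSpace lam θ₀ (a i) (b i)) :
    ∏ i ∈ s, F i ∈ secularSpace lam θ₀ (∑ i ∈ s, a i) (∑ i ∈ s, b i) := by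
  classical
  induction s using Finset.induction_on with
  | empty => exact one_mem_secularSpace
  | insert i s hi ih =>
    rw [Finset.prod_insert hi, Finset.sum_insert hi, Finset.sum_insert hi]
    exact mul_mem_secularSpace (h i (Finset.mem_insert_self i s))
      (ih fun j hj => h j (Finset.mem_insert_of_mem hj))

theorem secularSpace_differentiable {y : ℝ → ℂ → ℂ} (hy : y ∈ secularSpace lam θ₀ m n) (t : ℝ) :
    Differentiable ℂ (y t) := by
  induction hy using Submodule.span_induction with
  | mem y hy =>
    obtain ⟨M, L, f, hf, g, hg, -, -, rfl⟩ := hy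
    exact ((hf.1.const_mul _).add (hg.1.const_mul _)).const_mul _
  | zero => exact differentiable_const 0
  | add y y' _ _ h h' => exact h.add h'
  | smul c y _ h => exact h.const_smul c

theorem secularSpace_contDiff {y : ℝ → ℂ → ℂ} (hy : y ∈ secularSpace lam θ₀ m n) (z : ℂ) :
    ContDiff ℝ 2 fun t => y t z := by
  induction hy using Submodule.span_induction with
  | mem y hy =>
    obtain ⟨M, L, f, hf, g, hg, -, -, rfl⟩ := hy
    have hp : ContDiff ℝ 2 fun t : ℝ => (L : ℝ) * phase lam θ₀ t :=
      contDiff_const.mul ((contDiff_const.mul contDiff_id).add contDiff_const)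
    have hc : ContDiff ℝ 2 (cosL lam θ₀ L) := Complex.ofRealCLM.contDiff.comp hp.cos
    have hs : ContDiff ℝ 2 (sinL lam θ₀ L) := Complex.ofRealCLM.contDiff.comp hp.sin
    have ht : ContDiff ℝ 2 fun t : ℝ => (t : ℂ) ^ M := Complex.ofRealCLM.contDiff.pow M
    exact ht.mul ((hc.mul contDiff_const).add (hs.mul contDiff_const))
  | zero => exact contDiff_const
  | add y y' _ _ h h' => exact h.add h'
  | smul c y _ h => exact h.const_smul c

/-- Operators in `z` that are linear on entire functions and preserve reality act on the secular
space. -/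
theorem map_mem_secularSpace {T : (ℂ → ℂ) → ℂ → ℂ} (hT : ∀ f ∈ entireFun True, T f ∈ entireFun True)
    (hadd : ∀ {f g : ℂ → ℂ}, Differentiable ℂ f → Differentiable ℂ g → ∀ z,
      T (fun w => f w + g w) z = T f z + T g z)
    (hmul : ∀ {f : ℂ → ℂ}, Differentiable ℂ f → ∀ c z, T (fun w => c * f w) z = c * T f z)
    {y : ℝ → ℂ → ℂ} (hy : y ∈ secularSpace lam θ₀ m n) :
    (fun t => T (y t)) ∈ secularSpace lam θ₀ m n := by
  induction hy using Submodule.span_induction with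
  | mem y hy =>
    obtain ⟨M, L, f, hf, g, hg, hM, hL, rfl⟩ := hy
    convert monomial_mem_secularSpace hM hL (hT f hf) (hT g hg) using 1
    funext t z
    have hd : Differentiable ℂ fun w => cosL lam θ₀ L t * f w + sinL lam θ₀ L t * g w :=
      (hf.1.const_mul _).add (hg.1.const_mul _)
    dsimp only
    rw [hmul hd,
      hadd (hf.1.const_mul _) (hg.1.const_mul _), hmul hf.1, hmul hg.1]
  | zero =>
    convert (secularSpace lam θ₀ m n).zero_mem using 1
    funext t z
    have := hmul (differentiable_const (0 : ℂ)) 0 z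
    simp only [zero_mul] at this
    exact this
  | add y y' hy hy' h h' =>
    convert (secularSpace lam θ₀ m n).add_mem h h' using 1
    funext t z
    exact hadd (secularSpace_differentiable hy t) (secularSpace_differentiable hy' t) z
  | smul c y hy h =>
    convert (secularSpace lam θ₀ m n).smul_mem c h using 1
    funext t z
    exact hmul (secularSpace_differentiable hy t) c z

theorem deriv_mem_secularSpace {y : ℝ → ℂ → ℂ} (hy : y ∈ secularSpace lam θ₀ m n) :
    (fun t => deriv (y t)) ∈ secularSpace lam θ₀ m n :=
  map_mem_secularSpace (fun _ => deriv_mem_entireFun) (fun hf hg z => deriv_fun_add (hf z) (hg z))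
    (fun hf c z => deriv_const_mul c (hf z)) hy

theorem radialLaplacian_mem_secularSpace (N : ℝ) {y : ℝ → ℂ → ℂ}
    (hy : y ∈ secularSpace lam θ₀ m n) :
    (fun t => radialLaplacian N (y t)) ∈ secularSpace lam θ₀ m n :=
  map_mem_secularSpace (fun _ => radialLaplacian_mem_entireFun N)
    (fun hf hg => radialLaplacian_add N hf hg) (fun hf => radialLaplacian_const_mul N hf) hy

theorem waveOp_add (N : ℝ) {y y' : ℝ → ℂ → ℂ} (hy : y ∈ secularSpace lam θ₀ m n)
    (hy' : y' ∈ secularSpace lam θ₀ m n) (t : ℝ) (z : ℂ) :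
    waveOp N (y + y') t z = waveOp N y t z + waveOp N y' t z := by
  have h1 : deriv (deriv fun s => (y + y') s z) t =
      deriv (deriv fun s => y s z) t + deriv (deriv fun s => y' s z) t := by
    have := iteratedDeriv_fun_add (n := 2) (x := t) (secularSpace_contDiff hy z).contDiffAt
      (secularSpace_contDiff hy' z).contDiffAt
    simpa [iteratedDeriv_succ] using this
  have h2 := radialLaplacian_add N (secularSpace_differentiable hy t)
    (secularSpace_differentiable hy' t) z
  have h3 : (y + y') t = fun w => y t w + y' t w := rfl
  rw [waveOp, h1, h3, h2, waveOp, waveOp]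
  ring

theorem waveOp_smul (N : ℝ) {y : ℝ → ℂ → ℂ} (hy : y ∈ secularSpace lam θ₀ m n)
    (c : ℝ) (t : ℝ) (z : ℂ) : waveOp N (c • y) t z = c * waveOp N y t z := by
  have h1 : deriv (deriv fun s => (c • y) s z) t = c * deriv (deriv fun s => y s z) t := by
    have h : ∀ {u : ℝ → ℂ}, deriv (fun s => (c : ℂ) * u s) = fun s => (c : ℂ) * deriv u s :=
      fun {u} => funext fun s => deriv_const_mul_field (c : ℂ)
    have e : (fun s => (c • y) s z) = fun s => (c : ℂ) * y s z := rfl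
    rw [e, h, h]
  have h2 := radialLaplacian_const_mul N (secularSpace_differentiable hy t) (c : ℂ) z
  have h3 : (c • y) t = fun w => (c : ℂ) * y t w := rfl
  rw [waveOp, h1, h3, h2, waveOp]
  ring

/-- The Dirichlet problem for the wave equation is solvable in the secular spaces, at the cost
of one power of `t`. -/
theorem exists_secular_solution {N : ℝ} (hN : 0 < N) {s : ℝ → ℂ → ℂ}
    (hs : s ∈ secularSpace lam θ₀ m n) :
    ∃ y ∈ secularSpace lam θ₀ (m + 1) n,
      (∀ t z, waveOp N y t z = s t z) ∧ ∀ t, y t 1 = 0 := by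
  induction hs using Submodule.span_induction with
  | mem s hs =>
    obtain ⟨M, L, f, hf, g, hg, hM, hL, rfl⟩ := hs
    obtain ⟨Y, Z, hd, h1, hre, heq⟩ := hasTrigPolySolution hN lam θ₀ M L True hf.1 hg.1 hf.2 hg.2
    refine ⟨trigPoly lam θ₀ M L Y Z, ?_, heq, fun t => by simp [trigPoly, h1]⟩
    have : trigPoly lam θ₀ M L Y Z = ∑ i ∈ Finset.range (M + 2), fun (t : ℝ) (z : ℂ) =>
        (t : ℂ) ^ i * (cosL lam θ₀ L t * Y i z + sinL lam θ₀ L t * Z i z) := by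
      funext t z
      simp [trigPoly, Finset.sum_apply]
    rw [this]
    refine Submodule.sum_mem _ fun i hi => ?_
    rw [Finset.mem_range] at hi
    exact monomial_mem_secularSpace (by omega) hL ⟨(hd i).1, fun h => (hre h i).1⟩
      ⟨(hd i).2, fun h => (hre h i).2⟩
  | zero =>
    refine ⟨0, Submodule.zero_mem _, fun t z => ?_, fun _ => rfl⟩
    have := waveOp_smul N (secularSpace lam θ₀ m n).zero_mem 0 t z
    simpa using this
  | add s s' _ _ h h' =>
    obtain ⟨y, hy, he, h1⟩ := h
    obtain ⟨y', hy', he', h1'⟩ := h'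
    refine ⟨y + y', Submodule.add_mem _ hy hy', fun t z => ?_, fun t => by simp [h1, h1']⟩
    rw [waveOp_add N hy hy', he, he']
    rfl
  | smul c s _ h =>
    obtain ⟨y, hy, he, h1⟩ := h
    refine ⟨c • y, Submodule.smul_mem _ c hy, fun t z => ?_, fun t => by simp [h1]⟩
    rw [waveOp_smul N hy, he]
    rfl

/-- A function in the secular space, written as a double sum over all powers of `t` and all
frequencies. -/
theorem exists_coefficients {y : ℝ → ℂ → ℂ} (hy : y ∈ secularSpace lam θ₀ m n) :
    ∃ V W : ℕ → ℕ → ℂ → ℂ, (∀ L M, V L M ∈ entireFun True ∧ W L M ∈ entireFun True) ∧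
      ∀ (t : ℝ) (z : ℂ), y t z =
        ∑ M ∈ Finset.range (m + 1), ∑ L ∈ Finset.range (n + 1),
          (t : ℂ) ^ M * (cosL lam θ₀ L t * V L M z + sinL lam θ₀ L t * W L M z) := by
  induction hy using Submodule.span_induction with
  | mem y hy =>
    obtain ⟨M, L, f, hf, g, hg, hM, hL, rfl⟩ := hy
    refine ⟨fun L' M' => if L' = L ∧ M' = M then f else 0,
      fun L' M' => if L' = L ∧ M' = M then g else 0, fun L' M' => ?_, fun t z => ?_⟩
    · dsimp only
      split_ifs
      exacts [⟨hf, hg⟩, ⟨Submodule.zero_mem _, Submodule.zero_mem _⟩]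
    · rw [Finset.sum_eq_single M, Finset.sum_eq_single L]
      · simp
      · intro L' _ h
        simp [h]
      · intro h
        exact absurd (Finset.mem_range.2 (by omega)) h
      · intro M' _ h
        exact Finset.sum_eq_zero fun L' _ => by simp [h]
      · intro h
        exact absurd (Finset.mem_range.2 (by omega)) h
  | zero => exact ⟨0, 0, fun _ _ => ⟨Submodule.zero_mem _, Submodule.zero_mem _⟩, by simp⟩
  | add y y' _ _ h h' =>
    obtain ⟨V, W, hVW, he⟩ := h
    obtain ⟨V', W', hVW', he'⟩ := h'
    refine ⟨V + V', W + W', fun L M => ⟨Submodule.add_mem _ (hVW L M).1 (hVW' L M).1,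
      Submodule.add_mem _ (hVW L M).2 (hVW' L M).2⟩, fun t z => ?_⟩
    simp only [Pi.add_apply, he, he', ← Finset.sum_add_distrib]
    refine Finset.sum_congr rfl fun M _ => Finset.sum_congr rfl fun L _ => ?_
    ring
  | smul c y _ h =>
    obtain ⟨V, W, hVW, he⟩ := h
    refine ⟨c • V, c • W, fun L M => ⟨Submodule.smul_mem _ c (hVW L M).1,
      Submodule.smul_mem _ c (hVW L M).2⟩, fun t z => ?_⟩
    simp only [Pi.smul_apply, he, Finset.smul_sum, Complex.real_smul]
    refine Finset.sum_congr rfl fun M _ => Finset.sum_congr rfl fun L _ => ?_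
    ring

/-! ### The formal expansion -/

theorem posTuples_pos {n k : ℕ} {j : Fin n → ℕ} (hj : j ∈ posTuples n k) (i : Fin n) : 1 ≤ j i :=
  (Finset.mem_filter.1 hj).2 i

theorem posTuples_sum {n k : ℕ} {j : Fin n → ℕ} (hj : j ∈ posTuples n k) : ∑ i, j i = k :=
  Finset.Nat.mem_antidiagonalTuple.1 (Finset.mem_filter.1 hj).1

/-- Subtracting `1` from each entry: the `t`-degrees `j_i - 1` of the factors add up to `k - n`. -/
theorem posTuples_sum_sub_one {n k : ℕ} {j : Fin n → ℕ} (hj : j ∈ posTuples n k) :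
    ∑ i, (j i - 1) + n = k := by
  have h : ∑ i, (j i - 1 + 1) = k := by
    rw [← posTuples_sum hj]
    exact Finset.sum_congr rfl fun i _ => Nat.sub_add_cancel (posTuples_pos hj i)
  simpa [Finset.sum_add_distrib] using h

theorem posTuples_lt {n k : ℕ} (hn : 2 ≤ n) {j : Fin n → ℕ} (hj : j ∈ posTuples n k) (i : Fin n) :
    j i < k := by
  have h1 := posTuples_sum_sub_one hj
  have h2 : j i - 1 ≤ ∑ i, (j i - 1) :=
    Finset.single_le_sum (f := fun i => j i - 1) (fun _ _ => Nat.zero_le _) (Finset.mem_univ i)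
  omega

/-- The source of order `k` involves only the terms of lower order. -/
theorem expansionRHS_congr (N : ℝ) {y y' : ℕ → ℝ → ℂ → ℂ} {k : ℕ} (h : ∀ j < k, y j = y' j)
    (t : ℝ) (z : ℂ) : expansionRHS N y k t z = expansionRHS N y' k t z := by
  unfold expansionRHS
  congr 1
  · refine Finset.sum_congr rfl fun l hl => Finset.sum_congr rfl fun j hj => ?_
    have hlt := posTuples_lt (by have := (Finset.mem_Icc.1 hl).1; omega) hj
    simp only [fun i => h _ (hlt i)]
  · refine Finset.sum_congr rfl fun l hl => Finset.sum_congr rfl fun j hj => ?_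
    have hlt := posTuples_lt (Finset.mem_Icc.1 hl).1 hj
    simp only [fun i => h _ (hlt i)]

/-- A product of at least two factors with total order `k` has degree at most `k - 2` in `t`. -/
theorem expansionRHS_mem (N : ℝ) {y : ℕ → ℝ → ℂ → ℂ} {k : ℕ}
    (h : ∀ j < k, 1 ≤ j → y j ∈ secularSpace lam θ₀ (j - 1) j) :
    expansionRHS N y k ∈ secularSpace lam θ₀ (k - 2) k := by
  have hfactor : ∀ {l : ℕ}, 2 ≤ l → ∀ j ∈ posTuples l k, ∀ i,
      y (j i) ∈ secularSpace lam θ₀ (j i - 1) (j i) := fun hl j hj i =>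
    h _ (posTuples_lt hl hj i) (posTuples_pos hj i)
  have hneg : ∀ {a : ℕ}, y a ∈ secularSpace lam θ₀ (a - 1) a →
      (fun t z => -deriv (y a t) z) ∈ secularSpace lam θ₀ (a - 1) a := fun ha =>
    Submodule.neg_mem _ (deriv_mem_secularSpace ha)
  have e : expansionRHS N y k =
      (∑ l ∈ Finset.Icc 1 k, ∑ j ∈ posTuples (l + 1) k, taylorCoef (gasGI N) l •
        ((∏ i : Fin l, fun t z => -deriv (y (j i.castSucc) t) z) *
          fun t => radialLaplacian N (y (j (Fin.last l)) t))) +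
      ∑ l ∈ Finset.Icc 2 k, ∑ j ∈ posTuples l k, taylorCoef (gasGII N) l •
        ∏ i : Fin l, fun t z => -deriv (y (j i) t) z := by
    funext t z
    simp [expansionRHS, Finset.sum_apply, Finset.prod_apply, mul_assoc]
  rw [e]
  refine Submodule.add_mem _
    (Submodule.sum_mem _ fun l hl => Submodule.sum_mem _ fun j hj => Submodule.smul_mem _ _ ?_)
    (Submodule.sum_mem _ fun l hl => Submodule.sum_mem _ fun j hj => Submodule.smul_mem _ _ ?_)
  · have hl1 := (Finset.mem_Icc.1 hl).1
    have hf := hfactor (by omega) j hj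
    refine secularSpace_mono ?_ ?_ (mul_mem_secularSpace
      (prod_mem_secularSpace Finset.univ fun i _ => hneg (hf i.castSucc))
      (radialLaplacian_mem_secularSpace N (hf (Fin.last l))))
    · have := posTuples_sum_sub_one hj
      rw [Fin.sum_univ_castSucc] at this
      omega
    · have := posTuples_sum hj
      rw [Fin.sum_univ_castSucc] at this
      exact this.le
  · have hl2 := (Finset.mem_Icc.1 hl).1
    have hf := hfactor hl2 j hj
    refine secularSpace_mono ?_ ?_ (prod_mem_secularSpace Finset.univ fun i _ => hneg (hf i))
    · have := posTuples_sum_sub_one hj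
      omega
    · exact (posTuples_sum hj).le

/-- The terms `y_k`, chosen recursively in `k`: for `k ≠ 1` any solution, in the appropriate secular
space, of the problem whose source is built from the terms of lower order. -/
def expansionTerm (N lam θ₀ : ℝ) (k : ℕ) : ℝ → ℂ → ℂ :=
  if k = 1 then fun t z => sinL lam θ₀ 1 t * eigenfunction N lam z
  else Classical.epsilon fun u => u ∈ secularSpace lam θ₀ (k - 1) k ∧
    (∀ t z, waveOp N u t z =
      expansionRHS N (fun j => if _ : j < k then expansionTerm N lam θ₀ j else 0) k t z) ∧
    ∀ t, u t 1 = 0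
  termination_by k

theorem expansionTerm_one (N lam θ₀ : ℝ) :
    expansionTerm N lam θ₀ 1 = fun t z => sinL lam θ₀ 1 t * eigenfunction N lam z := by
  rw [expansionTerm, if_pos rfl]

theorem IsDirichletEigenvalue.pos {N lam : ℝ} (h : IsDirichletEigenvalue N lam) : 0 < lam := by
  obtain ⟨j, hj, -, rfl⟩ := h
  positivity

theorem IsDirichletEigenvalue.besselPhi_eq_zero {N lam : ℝ} (h : IsDirichletEigenvalue N lam) :
    besselPhi (N / 2 - 1) lam = 0 := by
  obtain ⟨j, hj, h0, rfl⟩ := h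
  have : (((j / 2) ^ (N / 2 - 1) : ℝ) : ℂ) ≠ 0 :=
    Complex.ofReal_ne_zero.2 (Real.rpow_pos_of_pos (by positivity) _).ne'
  exact (mul_eq_zero.1 h0).resolve_left this

theorem eigenfunction_mem {N : ℝ} (hN : 0 < N) (lam : ℝ) : eigenfunction N lam ∈ entireFun True := by
  have hb : 0 < N / 2 := by positivity
  set w := weightedNorm N fun w => besselPhi (N / 2 - 1) ((lam : ℂ) * w) with hw
  have h1 : (fun z => besselPhi (N / 2 - 1) ((lam : ℂ) * z)) ∈ entireFun True :=
    ⟨(differentiable_besselPhi hb).comp (differentiable_id.const_mul _),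
      fun _ => (realOnReal_besselPhi hb).comp_ofReal_mul lam⟩
  convert (entireFun True).smul_mem w⁻¹ h1 using 1
  funext z
  rw [eigenfunction, ← hw, Pi.smul_apply, Complex.real_smul, Complex.ofReal_inv, div_eq_mul_inv,
    mul_comm]

theorem eigenfunction_one {N lam : ℝ} (h : IsDirichletEigenvalue N lam) :
    eigenfunction N lam 1 = 0 := by
  rw [eigenfunction, mul_one, h.besselPhi_eq_zero, zero_div]

theorem eigenfunction_eq {N lam : ℝ} (hN : 0 < N) (z : ℂ) :
    radialLaplacian N (eigenfunction N lam) z = -(lam * eigenfunction N lam z) := by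
  have hb : 0 < N / 2 := by positivity
  have hd := differentiable_besselPhi hb
  set w := weightedNorm N fun w => besselPhi (N / 2 - 1) ((lam : ℂ) * w) with hw
  have e : eigenfunction N lam = fun z => (w : ℂ)⁻¹ * besselPhi (N / 2 - 1) ((lam : ℂ) * z) := by
    funext z
    rw [eigenfunction, ← hw, div_eq_mul_inv, mul_comm]
  have h1 := scaled_ode hd (besselPhi_ode hb) lam z
  have hφ : Differentiable ℂ fun z => besselPhi (N / 2 - 1) ((lam : ℂ) * z) :=
    hd.comp (differentiable_id.const_mul _)
  rw [e, radialLaplacian_const_mul N hφ, radialLaplacian]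
  linear_combination (w : ℂ)⁻¹ * h1

theorem waveOp_first_term {N lam θ₀ : ℝ} (hN : 0 < N) (hlam : 0 ≤ lam) (t : ℝ) (z : ℂ) :
    waveOp N (fun t z => sinL lam θ₀ 1 t * eigenfunction N lam z) t z = 0 := by
  have e1 : (deriv fun s => sinL lam θ₀ 1 s * eigenfunction N lam z) = fun s =>
      (((1 : ℕ) * Real.sqrt lam : ℝ) : ℂ) * cosL lam θ₀ 1 s * eigenfunction N lam z :=
    funext fun s => ((hasDerivAt_sinL lam θ₀ 1 s).mul_const _).deriv
  have e2 := (((hasDerivAt_cosL lam θ₀ 1 t).const_mul (((1 : ℕ) * Real.sqrt lam : ℝ) : ℂ)).mul_const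
    (eigenfunction N lam z)).deriv
  have e3 : (Real.sqrt lam : ℂ) ^ 2 = lam := by
    rw [← Complex.ofReal_pow, Real.sq_sqrt hlam]
  rw [waveOp, e1, e2, radialLaplacian_const_mul N (eigenfunction_mem hN lam).1,
    eigenfunction_eq hN]
  push_cast
  linear_combination (-sinL lam θ₀ 1 t * eigenfunction N lam z) * e3

/-- The sums over `ℓ` start with products of two factors, so there is no source of order `1`. -/
theorem expansionRHS_one (N : ℝ) (y : ℕ → ℝ → ℂ → ℂ) (t : ℝ) (z : ℂ) :
    expansionRHS N y 1 t z = 0 := by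
  have h : posTuples 2 1 = ∅ := by
    refine Finset.eq_empty_of_forall_notMem fun j hj => ?_
    have := posTuples_sum_sub_one hj
    omega
  simp [expansionRHS, h]

theorem expansionTerm_spec {N : ℝ} (hN : 0 < N) (hlam : IsDirichletEigenvalue N lam) (k : ℕ)
    (hk : 1 ≤ k) : expansionTerm N lam θ₀ k ∈ secularSpace lam θ₀ (k - 1) k ∧
      (∀ t z, waveOp N (expansionTerm N lam θ₀ k) t z =
        expansionRHS N (expansionTerm N lam θ₀) k t z) ∧
      ∀ t, expansionTerm N lam θ₀ k t 1 = 0 := by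
  induction k using Nat.strong_induction_on with
  | _ k ih =>
    rcases eq_or_ne k 1 with rfl | hk1
    · rw [expansionTerm_one]
      refine ⟨?_, fun t z => ?_, fun t => by simp [eigenfunction_one hlam]⟩
      · convert monomial_mem_secularSpace (lam := lam) (θ₀ := θ₀) (le_refl (1 - 1)) (le_refl 1)
          (entireFun True).zero_mem (eigenfunction_mem hN lam) using 1
        funext t z
        simp
      · rw [waveOp_first_term hN hlam.pos.le, expansionRHS_one]
    · have hcongr := expansionRHS_congr N (k := k) (y := expansionTerm N lam θ₀)
        (y' := fun j => if _ : j < k then expansionTerm N lam θ₀ j else 0)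
        (fun j hj => by simp [hj])
      have hex : ∃ u, u ∈ secularSpace lam θ₀ (k - 1) k ∧
          (∀ t z, waveOp N u t z =
            expansionRHS N (fun j => if _ : j < k then expansionTerm N lam θ₀ j else 0) k t z) ∧
          ∀ t, u t 1 = 0 := by
        obtain ⟨u, hu, he, h1⟩ := exists_secular_solution hN
          (expansionRHS_mem N fun j hj hj1 => (ih j hj hj1).1)
        refine ⟨u, ?_, fun t z => (he t z).trans (hcongr t z), h1⟩
        rwa [show k - 2 + 1 = k - 1 by omega] at hu
      have hspec := Classical.epsilon_spec hex
      rw [← if_neg (c := k = 1) (t := fun t z => sinL lam θ₀ 1 t * eigenfunction N lam z) hk1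
        (e := Classical.epsilon _), ← expansionTerm] at hspec
      exact ⟨hspec.1, fun t z => (hspec.2.1 t z).trans (hcongr t z).symm, hspec.2.2⟩

end

end

theorem lemma1 (N : ℝ) (hN : 4 ≤ N) (lam θ₀ : ℝ) (hlam : IsDirichletEigenvalue N lam) :
    (∀ (M L : ℕ) (f : ℂ → ℂ), Differentiable ℂ f →
      HasTrigPolySolution N lam θ₀ M L (RealOnReal f)
        (fun t z => (t : ℂ) ^ M * cosL lam θ₀ L t * f z) ∧
      HasTrigPolySolution N lam θ₀ M L (RealOnReal f)
        (fun t z => (t : ℂ) ^ M * sinL lam θ₀ L t * f z)) ∧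
    ∃ y : ℕ → ℝ → ℂ → ℂ,
      (∀ (t : ℝ) (z : ℂ), y 1 t z = sinL lam θ₀ 1 t * eigenfunction N lam z) ∧
      ∀ k : ℕ, 1 ≤ k →
        (∀ (t : ℝ) (z : ℂ), waveOp N (y k) t z = expansionRHS N y k t z) ∧
        (∀ t : ℝ, y k t 1 = 0) ∧
        ∃ V W : ℕ → ℕ → ℂ → ℂ,
          (∀ L M, Differentiable ℂ (V L M) ∧ Differentiable ℂ (W L M)) ∧
          (∀ L M, RealOnReal (V L M) ∧ RealOnReal (W L M)) ∧
          ∀ (t : ℝ) (z : ℂ), y k t z =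
            ∑ M ∈ Finset.range k, ∑ L ∈ Finset.range (k + 1),
              (t : ℂ) ^ M * (cosL lam θ₀ L t * V L M z + sinL lam θ₀ L t * W L M z) := by
  have hN0 : 0 < N := by linarith
  have h0 : Differentiable ℂ fun _ : ℂ => (0 : ℂ) := differentiable_const 0
  have h0re : RealOnReal fun _ => 0 := fun x => by simp
  refine ⟨fun M L f hf => ⟨?_, ?_⟩, expansionTerm N lam θ₀, fun t z => by rw [expansionTerm_one],
    fun k hk => ?_⟩
  · simpa [mul_assoc] using
      hasTrigPolySolution hN0 lam θ₀ M L (RealOnReal f) hf h0 id fun _ => h0re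
  · simpa [mul_assoc] using
      hasTrigPolySolution hN0 lam θ₀ M L (RealOnReal f) h0 hf (fun _ => h0re) id
  · obtain ⟨hmem, heq, h1⟩ := expansionTerm_spec (θ₀ := θ₀) hN0 hlam k hk
    obtain ⟨V, W, hVW, hsum⟩ := exists_coefficients hmem
    rw [Nat.sub_add_cancel hk] at hsum
    exact ⟨heq, h1, V, W, fun L M => ⟨(hVW L M).1.1, (hVW L M).2.1⟩,
      fun L M => ⟨(hVW L M).1.2 trivial, (hVW L M).2.2 trivial⟩, hsum⟩
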